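/- **Memory.** Fix processes $\mathsf P=\{p_1,\dots,p_N\}$, a set $\mathsf{Var}$ of shared variables and a set $\mathsf{Val}$ of values with $0\in\mathsf{Val}$. A memory event is a pair of a process and one of the actions $\mathtt W(x,v)$ (write), $\mathtt R(x,v)$ (read), $\mathtt{RMW}(x,v_{\rm old},v_{\rm new})$, $\mathtt F$ (fence). A memory model is a labelled transition system (LTS) whose labels are memory events and a silent label $\tau$; its observable traces are its finite traces with $\tau$ erased. The three models are: * SCM: a state is a map $m:\mathsf{Var}\to\mathsf{Val}$, initially $0$; writes and successful RMWs update $m$ at once, $\mathtt R(x,v)$ and $\mathtt{RMW}(x,v,\cdot)$ require $m(x)=v$, and fences are no-ops. * TSO: as SCM, but every process has an (initially empty) FIFO store buffer; a write is appended to the writer's buffer; a $\tau$-step moves the oldest entry of some buffer to $m$; a read of $x$ returns the newest entry for $x$ in the reader's buffer, or $m(x)$ if there is none; RMWs (which act on $m$ directly) and fences of $p$ require $p$'s buffer to be empty. * RA: a state consists of a set of messages $\langle x,v,t,V\rangle$ with timestamp $t\in\mathbb N$ and view $V:\mathsf{Var}\to\mathbb N$, a view $V_p$ for each process $p$, and a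 fence view $V_f$; initially the messages are $\langle x,0,0,\lambda y.0\rangle$ for all $x$, and all views are $0$. A write of $v$ to $x$ by $p$ picks a timestamp $t>V_p(x)$ that no message of $x$ uses, sets $V_p(x):=t$ and adds $\langle x,v,t,V_p\rangle$. A read of $x$ returns the value of a message of $x$ with timestamp $V_p(x)$. An RMW reads like this and then writes with $t=V_p(x)+1$, which must be unused. A fence sets both $V_p$ and $V_f$ to $V_p\sqcup V_f$ ($\sqcup$ is the pointwise maximum). A $\tau$-step picks $p$ and a message $\langle x,v,t,V\rangle$ with $V_p(x)<t$ and sets $V_p:=V_p\sqcup V$. **Patterns.** A sequence $\sigma$ of memory events is *RBW* (read-before-write) if whenever a write to $x$ occurs before a read from some $y\ne x$, there is a write to $y$ strictly between them. It is *LF* if no fence is immediately preceded by a non-fence, *TF* if no fence is immediately followed by a non-fence, and *LTF* if $\sigma=\sigma'\cdot\sigma''$ with $\sigma'$ LF and $\sigma''$ TF (that is, it has no "middle" fence). **Histories and implementations.** A history is a sequence of invocations $(p,\mathsf{inv}(o))$ and responses $(p,\mathsf{res}(u))$. It is *sequential* if it is a prefix of a concatenation of blocks $(p,\mathsf{inv}(o))(p,\mathsf{res}(u))$,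 *well-formed* if its restriction to each process is sequential, and *complete* if it is well-formed and its restriction to each participating process ends with a response. A specification is a prefix-closed set of complete sequential histories. An implementation $\mathcal I$ assigns to each operation $o$ and process $p$ an LTS $\mathcal I(o,p)$ whose labels are (memory or object) events of $p$ and in which nothing is enabled after a response. The system of $\mathcal I$ interleaves the processes; each process repeatedly invokes an operation $o$, performs memory events as $\mathcal I(o,p)$ prescribes from its initial state, and responds when $\mathcal I(o,p)$ does. For a sequence $\pi$ of events, $\pi|_{\rm mem}$ and $\pi|_{\rm obj}$ are its subsequences of memory events and of object events. * $\mathcal I$ is *consistent under $M$* if for every trace $\pi$ of its system such that $\pi|_{\rm mem}$ is an observable trace of $M$ and $\pi|_{\rm obj}$ is complete, some history in the specification is a permutation of $\pi|_{\rm obj}$ that preserves the order of any two events of the same process and the order from each response to each later invocation. * $\mathcal I$ is *spec-available* if for all complete sequential histories $h_0,h$ with $h_0\cdot h$ in the specification, and every trace $\pi_0$ of its system with $\pi_0|_{\rm obj}=h_0$ and $\pi_0|_{\rm mem}$ a trace of SCM, there is $\pi$ with $\pi|_{\rm obj}=h$ such that $\pi_0\cdot\pi$ is a trace of the system and $(\pi_0\cdot\pi)|_{\rm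 mem}$ is a trace of SCM. **Snapshot.** Let $W$ be a set with $\bot\in W$, and let $A\subseteq W$ contain some $w\ne\bot$. The single-writer snapshot object has operations $\mathtt{update}(w)$ for $w\in A$ and $\mathtt{scan}$, and return values $\mathtt{ack}$ and all vectors in $\mathsf P\to W$. Its specification consists of the complete sequential histories in which each update returns $\mathtt{ack}$ and each scan returns the vector whose component at $p$ is the value of the last preceding update by $p$, or $\bot$ if there is none. **Theorem.** Let $M\in\{\mathrm{SCM},\mathrm{TSO},\mathrm{RA}\}$, let $N\ge 2$, and let $N\ge3$ if $M=\mathrm{RA}$. Let $\mathcal I$ be a spec-available implementation of the snapshot object that is consistent under $M$. Then there exist processes $p,p'$, a value $w\in A$, a trace $\pi_1$ of $\mathcal I(\mathtt{update}(w),p)$ and a trace $\pi_2$ of $\mathcal I(\mathtt{scan},p')$ such that, for $\sigma_1=\pi_1|_{\rm mem}$ and $\sigma_2=\pi_2|_{\rm mem}$: (a) if $M=\mathrm{SCM}$, then $\sigma_1\cdot\sigma_2$ has an RMW or is not RBW; (b) if $M=\mathrm{TSO}$, then $\sigma_1\cdot\sigma_2$ has an RMW or is not LTF; (c) if $M=\mathrm{RA}$,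 then $\sigma_1$ or $\sigma_2$ has an RMW, or $\sigma_1$ or $\sigma_2$ is not LTF. -/

import Mathlib

namespace WeakMem

universe a b c u v w s

/-! ### Labelled transition systems -/

/-- A labelled transition system with transition labels in `L`. -/
structure LTS (L : Type a) where
  State : Type b
  init : State
  Step : State → L → State → Prop

namespace LTS
variable {L : Type a}

/-- `S.Run q π q'`: there is an execution fragment from `q` to `q'` with trace `π`. -/
inductive Run (S : LTS.{a, b} L) : S.State → List L → S.State → Prop
  | nil (q : S.State) : Run S q [] q
  | cons {q q' q'' : S.State} {l : L} {π : List L} :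
      S.Step q l q' → Run S q' π q'' → Run S q (l :: π) q''

/-- The traces of an LTS (finite, from the initial state). -/
def traces (S : LTS.{a, b} L) : Set (List L) :=
  {π | ∃ q, S.Run S.init π q}

end LTS

/-! ### Memory actions, memory events, memory models -/

/-- Memory actions: writes, reads, read-modify-writes (with the old and the new value), fences. -/
inductive MemAct (Var : Type u) (Val : Type v) : Type (max u v)
  | W (x : Var) (v : Val)
  | R (x : Var) (v : Val)
  | RMW (x : Var) (vold vnew : Val)
  | F

/-- Memory events of the processes `0, …, N - 1`. -/
abbrev MemEv (N : ℕ) (Var : Type u) (Val : Type v) : Type (max u v) := Fin N × MemAct Var Val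

/-- A memory model is an LTS over memory events and the silent label `τ`, which is `none`. -/
abbrev MemoryModel (N : ℕ) (Var : Type u) (Val : Type v) :=
  LTS.{max u v, max u v} (Option (MemEv N Var Val))

/-- The observable traces of a memory model: its traces with the silent steps erased. -/
def otraces {N : ℕ} {Var : Type u} {Val : Type v} (M : MemoryModel N Var Val) :
    Set (List (MemEv N Var Val)) :=
  {σ | ∃ ρ ∈ M.traces, ρ.reduceOption = σ}

section Models
variable (N : ℕ) (Var : Type u) (Val : Type v)

open Classical in
/-- Transitions of the strongly consistent memory. -/
inductive SCMStep : (Var → Val) → Option (MemEv N Var Val) → (Var → Val) → Prop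
  | write (m : Var → Val) (p : Fin N) (x : Var) (v : Val) :
      SCMStep m (some (p, .W x v)) (Function.update m x v)
  | read (m : Var → Val) (p : Fin N) (x : Var) :
      SCMStep m (some (p, .R x (m x))) m
  | rmw (m : Var → Val) (p : Fin N) (x : Var) (vnew : Val) :
      SCMStep m (some (p, .RMW x (m x) vnew)) (Function.update m x vnew)
  | fence (m : Var → Val) (p : Fin N) :
      SCMStep m (some (p, .F)) m

/-- Strongly consistent memory. -/
def SCM [Zero Val] : MemoryModel N Var Val where
  State := Var → Val
  init := fun _ => 0
  Step := SCMStep N Var Val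

/-- States of TSO: a main memory and a FIFO store buffer (oldest entry first) per process. -/
structure TSOState where
  mem : Var → Val
  buf : Fin N → List (Var × Val)

variable {N Var Val} in
open Classical in
/-- The restriction of a store buffer to the entries of variable `x`. -/
noncomputable def bufRestrict (β : List (Var × Val)) (x : Var) : List (Var × Val) :=
  β.filter (fun e => e.1 = x)

open Classical in
/-- Transitions of TSO. -/
inductive TSOStep :
    TSOState N Var Val → Option (MemEv N Var Val) → TSOState N Var Val → Prop
  | write (m : Var → Val) (b : Fin N → List (Var × Val)) (p : Fin N) (x : Var) (v : Val) :
      TSOStep ⟨m, b⟩ (some (p, .W x v)) ⟨m, Function.update b p (b p ++ [(x, v)])⟩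
  | readFromBuffer (m : Var → Val) (b : Fin N → List (Var × Val)) (p : Fin N) (x : Var) (v : Val)
      (h : (bufRestrict (b p) x).getLast? = some (x, v)) :
      TSOStep ⟨m, b⟩ (some (p, .R x v)) ⟨m, b⟩
  | readFromMemory (m : Var → Val) (b : Fin N → List (Var × Val)) (p : Fin N) (x : Var)
      (h : bufRestrict (b p) x = []) :
      TSOStep ⟨m, b⟩ (some (p, .R x (m x))) ⟨m, b⟩
  | rmw (m : Var → Val) (b : Fin N → List (Var × Val)) (p : Fin N) (x : Var) (vnew : Val)
      (h : b p = []) :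
      TSOStep ⟨m, b⟩ (some (p, .RMW x (m x) vnew)) ⟨Function.update m x vnew, b⟩
  | fence (m : Var → Val) (b : Fin N → List (Var × Val)) (p : Fin N) (h : b p = []) :
      TSOStep ⟨m, b⟩ (some (p, .F)) ⟨m, b⟩
  | propagate (m : Var → Val) (b : Fin N → List (Var × Val)) (p : Fin N) (x : Var) (v : Val)
      (β : List (Var × Val)) (h : b p = (x, v) :: β) :
      TSOStep ⟨m, b⟩ none ⟨Function.update m x v, Function.update b p β⟩

/-- Total store order. -/
def TSO [Zero Val] : MemoryModel N Var Val where
  State := TSOState N Var Val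
  init := ⟨fun _ => 0, fun _ => []⟩
  Step := TSOStep N Var Val

/-- Views map every variable to a timestamp. -/
abbrev View := Var → ℕ

/-- Messages of release/acquire memory: variable, value, timestamp, view. -/
structure Msg where
  var : Var
  val : Val
  time : ℕ
  view : View Var

/-- States of release/acquire: the messages, the process views, the fence view. -/
structure RAState where
  mem : Set (Msg Var Val)
  pview : Fin N → View Var
  fview : View Var

open Classical in
/-- Transitions of release/acquire; `⊔` on views is the pointwise maximum. -/
inductive RAStep :
    RAState N Var Val → Option (MemEv N Var Val) → RAState N Var Val → Prop
  | write (m : Set (Msg Var Val)) (P : Fin N → View Var) (f : View Var)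
      (p : Fin N) (x : Var) (v : Val) (t : ℕ)
      (hlt : P p x < t) (hfree : ∀ μ ∈ m, μ.var = x → μ.time ≠ t) :
      RAStep ⟨m, P, f⟩ (some (p, .W x v))
        ⟨m ∪ {⟨x, v, t, Function.update (P p) x t⟩},
          Function.update P p (Function.update (P p) x t), f⟩
  | read (m : Set (Msg Var Val)) (P : Fin N → View Var) (f : View Var)
      (p : Fin N) (x : Var) (v : Val) (V : View Var)
      (h : (⟨x, v, P p x, V⟩ : Msg Var Val) ∈ m) :
      RAStep ⟨m, P, f⟩ (some (p, .R x v)) ⟨m, P, f⟩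
  | fence (m : Set (Msg Var Val)) (P : Fin N → View Var) (f : View Var) (p : Fin N) :
      RAStep ⟨m, P, f⟩ (some (p, .F)) ⟨m, Function.update P p (P p ⊔ f), P p ⊔ f⟩
  | rmw (m : Set (Msg Var Val)) (P : Fin N → View Var) (f : View Var)
      (p : Fin N) (x : Var) (vold vnew : Val) (V : View Var)
      (h : (⟨x, vold, P p x, V⟩ : Msg Var Val) ∈ m)
      (hfree : ∀ μ ∈ m, μ.var = x → μ.time ≠ P p x + 1) :
      RAStep ⟨m, P, f⟩ (some (p, .RMW x vold vnew))
        ⟨m ∪ {⟨x, vnew, P p x + 1, Function.update (P p) x (P p x + 1)⟩},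
          Function.update P p (Function.update (P p) x (P p x + 1)), f⟩
  | propagate (m : Set (Msg Var Val)) (P : Fin N → View Var) (f : View Var)
      (p : Fin N) (μ : Msg Var Val) (hμ : μ ∈ m) (hlt : P p μ.var < μ.time) :
      RAStep ⟨m, P, f⟩ none ⟨m, Function.update P p (P p ⊔ μ.view), f⟩

/-- Release/acquire memory. -/
def RA [Zero Val] : MemoryModel N Var Val where
  State := RAState N Var Val
  init := ⟨{μ | μ.val = 0 ∧ μ.time = 0 ∧ μ.view = fun _ => 0}, fun _ _ => 0, fun _ => 0⟩
  Step := RAStep N Var Val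

end Models

/-- Names of the three memory models. -/
inductive Model
  | SCM
  | TSO
  | RA

/-- The memory model with a given name. -/
def Model.lts (M : Model) (N : ℕ) (Var : Type u) (Val : Type v) [Zero Val] :
    MemoryModel N Var Val :=
  match M with
  | .SCM => WeakMem.SCM N Var Val
  | .TSO => WeakMem.TSO N Var Val
  | .RA => WeakMem.RA N Var Val

/-! ### Patterns of observable memory sequences -/

section Patterns
variable {N : ℕ} {Var : Type u} {Val : Type v}

/-- Some event of the sequence is an RMW. -/
def HasRMW (σ : List (MemEv N Var Val)) : Prop :=
  ∃ p x vold vnew, (p, MemAct.RMW x vold vnew) ∈ σ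

/-- Read-before-write: between a write to `x` and a later read from some `y ≠ x` there is
always a write to `y`. -/
def IsRBW (σ : List (MemEv N Var Val)) : Prop :=
  ∀ (k₁ k₂ : ℕ) (p₁ p₂ : Fin N) (x y : Var) (v₁ v₂ : Val), k₁ < k₂ →
    σ[k₁]? = some (p₁, .W x v₁) → σ[k₂]? = some (p₂, .R y v₂) → x ≠ y →
    ∃ (k : ℕ) (p : Fin N) (v : Val), k₁ < k ∧ k < k₂ ∧ σ[k]? = some (p, .W y v)

/-- Trailing-fence: no fence is immediately followed by a non-fence. -/
def IsTF (σ : List (MemEv N Var Val)) : Prop :=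
  ¬ ∃ (k : ℕ) (e e' : MemEv N Var Val),
    σ[k]? = some e ∧ σ[k + 1]? = some e' ∧ e.2 = .F ∧ e'.2 ≠ .F

/-- Leading-fence: no fence is immediately preceded by a non-fence. -/
def IsLF (σ : List (MemEv N Var Val)) : Prop :=
  ¬ ∃ (k : ℕ) (e e' : MemEv N Var Val),
    σ[k]? = some e ∧ σ[k + 1]? = some e' ∧ e.2 ≠ .F ∧ e'.2 = .F

/-- Leading-and-trailing-fence. -/
def IsLTF (σ : List (MemEv N Var Val)) : Prop :=
  ∃ σ₁ σ₂, σ = σ₁ ++ σ₂ ∧ IsLF σ₁ ∧ IsTF σ₂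

end Patterns

/-! ### Objects and histories -/

/-- Object actions: invocations of operations and responses with a return value. -/
inductive ObjAct (Op : Type a) (Ret : Type b) : Type (max a b)
  | inv (o : Op)
  | res (r : Ret)

/-- Object events. -/
abbrev ObjEv (N : ℕ) (Op : Type a) (Ret : Type b) : Type (max a b) := Fin N × ObjAct Op Ret

section Histories
variable {N : ℕ} {Op : Type a} {Ret : Type b}

/-- The history that consists of process `p` invoking `o` and receiving the response `r`. -/
def opHistory (p : Fin N) (o : Op) (r : Ret) : List (ObjEv N Op Ret) :=
  [(p, .inv o), (p, .res r)]

/-- Sequential histories: prefixes of concatenations of single complete operations. -/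
def IsSequential (h : List (ObjEv N Op Ret)) : Prop :=
  ∃ l : List (Fin N × Op × Ret), h <+: l.flatMap (fun t => opHistory t.1 t.2.1 t.2.2)

/-- The events of process `p` in a history. -/
def procRestrict (h : List (ObjEv N Op Ret)) (p : Fin N) : List (ObjEv N Op Ret) :=
  h.filter (fun e => e.1 = p)

/-- Well-formed histories: the events of each process form a sequential history. -/
def IsWellFormed (h : List (ObjEv N Op Ret)) : Prop :=
  ∀ p, IsSequential (procRestrict h p)

/-- Complete histories: well-formed, and the events of each process that takes part in the
history end with a response. -/
def IsComplete (h : List (ObjEv N Op Ret)) : Prop :=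
  IsWellFormed h ∧ ∀ p e, (procRestrict h p).getLast? = some e → ∃ r, e.2 = .res r

/-- Complete sequential histories. -/
def IsCompleteSequential (h : List (ObjEv N Op Ret)) : Prop :=
  IsComplete h ∧ IsSequential h

/-- `s'` is an `R`-reordering of `s`. -/
def IsReordering {X : Type a} (R : X → X → Prop) (s s' : List X) : Prop :=
  ∃ f : Fin s.length ≃ Fin s'.length,
    (∀ i, s.get i = s'.get (f i)) ∧ ∀ i j, i < j → R (s.get i) (s.get j) → f i < f j

/-- The order that a linearization preserves: the order of the events of one process, and the
order from a response to a later invocation. -/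
def LinRel (e₁ e₂ : ObjEv N Op Ret) : Prop :=
  e₁.1 = e₂.1 ∨ ((∃ r, e₁.2 = .res r) ∧ ∃ o, e₂.2 = .inv o)

/-- The history `h'` linearizes the history `h`. -/
def Linearizes (h h' : List (ObjEv N Op Ret)) : Prop :=
  IsWellFormed h ∧ IsWellFormed h' ∧ IsReordering LinRel h h'

end Histories

/-- An object for the processes `0, …, N - 1`: operations, return values, and a
prefix-closed specification that consists of complete sequential histories. -/
structure Obj (N : ℕ) where
  Op : Type a
  Ret : Type b
  Spec : Set (List (ObjEv N Op Ret))
  spec_cs : ∀ h ∈ Spec, IsCompleteSequential h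
  spec_prefix : ∀ h ∈ Spec, ∀ h', IsCompleteSequential h' → h' <+: h → h' ∈ Spec

/-! ### Implementations -/

/-- Events of the implementation of an object: memory events and object events. -/
inductive Event (N : ℕ) (Var : Type u) (Val : Type v) (Op : Type a) (Ret : Type b) :
    Type (max u v a b)
  | mem (e : MemEv N Var Val)
  | obj (e : ObjEv N Op Ret)

section Events
variable {N : ℕ} {Var : Type u} {Val : Type v} {Op : Type a} {Ret : Type b}

/-- The process of an event. -/
def Event.proc : Event N Var Val Op Ret → Fin N
  | .mem e => e.1
  | .obj e => e.1

/-- The memory event in an event, if it is one. -/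
def Event.mem? : Event N Var Val Op Ret → Option (MemEv N Var Val)
  | .mem e => some e
  | .obj _ => none

/-- The object event in an event, if it is one. -/
def Event.obj? : Event N Var Val Op Ret → Option (ObjEv N Op Ret)
  | .mem _ => none
  | .obj e => some e

/-- The memory events of a sequence of events. -/
def memPart (π : List (Event N Var Val Op Ret)) : List (MemEv N Var Val) :=
  π.filterMap Event.mem?

/-- The object events of a sequence of events. -/
def objPart (π : List (Event N Var Val Op Ret)) : List (ObjEv N Op Ret) :=
  π.filterMap Event.obj?

end Events

/-- An implementation of an operation for process `p`: an LTS whose labels are events of `p`,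
in which no transition is enabled after a response. -/
structure OpImpl (N : ℕ) (Var : Type u) (Val : Type v) (Op : Type a) (Ret : Type b) (p : Fin N)
    extends LTS.{max u v a b, s} (Event N Var Val Op Ret) where
  proc_eq : ∀ q e q', Step q e q' → e.proc = p
  res_last : ∀ q r q', Step q (.obj (p, .res r)) q' → ∀ e q'', ¬ Step q' e q''

/-- An implementation of an object: an implementation of each operation for each process. -/
def Implementation {N : ℕ} (Var : Type u) (Val : Type v) (O : Obj.{a, b} N) :=
  (o : O.Op) → (p : Fin N) → OpImpl.{a, b, u, v, s} N Var Val O.Op O.Ret p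

namespace Implementation
variable {N : ℕ} {Var : Type u} {Val : Type v} {O : Obj.{a, b} N}

/-- States of process `p`: idle (`none`), or executing `o` in some state of its
implementation. -/
abbrev ProcState (I : Implementation.{a, b, u, v, s} Var Val O) (p : Fin N) :=
  Option (Σ o : O.Op, (I o p).State)

/-- Transitions of process `p`. -/
inductive ProcStep (I : Implementation.{a, b, u, v, s} Var Val O) (p : Fin N) :
    I.ProcState p → Event N Var Val O.Op O.Ret → I.ProcState p → Prop
  | invoke (o : O.Op) :
      ProcStep I p none (.obj (p, .inv o)) (some ⟨o, (I o p).init⟩)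
  | memory (o : O.Op) (q q' : (I o p).State) (e : MemEv N Var Val)
      (h : (I o p).Step q (.mem e) q') :
      ProcStep I p (some ⟨o, q⟩) (.mem e) (some ⟨o, q'⟩)
  | respond (o : O.Op) (q q' : (I o p).State) (r : O.Ret)
      (h : (I o p).Step q (.obj (p, .res r)) q') :
      ProcStep I p (some ⟨o, q⟩) (.obj (p, .res r)) none

/-- The LTS induced by an implementation: it interleaves the transitions of the processes. -/
def sys (I : Implementation.{a, b, u, v, s} Var Val O) :
    LTS.{max u v a b, max a s} (Event N Var Val O.Op O.Ret) where
  State := (p : Fin N) → I.ProcState p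
  init := fun _ => none
  Step := fun q e q' => ∃ p q₁, I.ProcStep p (q p) e q₁ ∧ q' = Function.update q p q₁

/-- The histories generated by `I` after `π₀` under the memory model `M`. -/
def histories (I : Implementation.{a, b, u, v, s} Var Val O)
    (π₀ : List (Event N Var Val O.Op O.Ret)) (M : MemoryModel N Var Val) :
    Set (List (ObjEv N O.Op O.Ret)) :=
  {h | ∃ π, h = objPart π ∧ π₀ ++ π ∈ I.sys.traces ∧ memPart (π₀ ++ π) ∈ otraces M}

/-- Consistency under `M`: every complete history generated under `M` is linearized by a history
of the specification. -/
def Consistent (I : Implementation.{a, b, u, v, s} Var Val O) (M : MemoryModel N Var Val) :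
    Prop :=
  ∀ h ∈ I.histories [] M, IsComplete h → ∃ h' ∈ O.Spec, Linearizes h h'

/-- Availability after `h₀` with respect to `h`. -/
def AvailableAfter [Zero Val] (I : Implementation.{a, b, u, v, s} Var Val O)
    (h₀ h : List (ObjEv N O.Op O.Ret)) : Prop :=
  ∀ π₀ ∈ I.sys.traces, memPart π₀ ∈ otraces (SCM N Var Val) → objPart π₀ = h₀ →
    h ∈ I.histories π₀ (SCM N Var Val)

/-- Spec-availability. -/
def SpecAvailable [Zero Val] (I : Implementation.{a, b, u, v, s} Var Val O) : Prop :=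
  ∀ h₀ h, IsCompleteSequential h₀ → IsCompleteSequential h → h₀ ++ h ∈ O.Spec →
    I.AvailableAfter h₀ h

end Implementation

/-! ### The single-writer snapshot object -/

/-- Operations of the snapshot object whose updates write values from `A`. -/
inductive SnapOp {W : Type w} (A : Set W) : Type w
  | update (x : A)
  | scan

/-- Return values of the snapshot object. -/
inductive SnapRet (N : ℕ) (W : Type w) : Type w
  | ack
  | vec (x : Fin N → W)

section Snapshot
variable {N : ℕ} {W : Type w} {A : Set W}

/-- The vector stored after a history, starting from the vector `x`: component `p` is the value
of the last update by process `p`, or the initial one if there is no such update. -/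
def snapState (x : Fin N → W) : List (ObjEv N (SnapOp A) (SnapRet N W)) → (Fin N → W)
  | [] => x
  | (p, .inv (.update y)) :: h => snapState (Function.update x p y) h
  | _ :: h => snapState x h

variable (N A) in
/-- The single-writer snapshot object, initially `⊥` in every component: updates return `ack`,
and a scan returns the vector of the last values written by the processes. -/
def snapshot [Bot W] : Obj.{w, w} N where
  Op := SnapOp A
  Ret := SnapRet N W
  Spec := {h | IsCompleteSequential h ∧ ∀ h₁ p o r h₂, h = h₁ ++ opHistory p o r ++ h₂ →
    match o with
    | .update _ => r = .ack
    | .scan => r = .vec (snapState (fun _ => ⊥) h₁)}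
  spec_cs := fun _ h => h.1
  spec_prefix := by
    rintro h ⟨-, hs⟩ h' hc ⟨t, rfl⟩
    refine ⟨hc, ?_⟩
    rintro h₁ p o r h₂ rfl
    exact hs h₁ p o r (h₂ ++ t) (by simp)

end Snapshot

end WeakMem

open WeakMem

namespace WeakMem

universe a b c u v w s

/-! ### Runs -/

namespace LTS
variable {L : Type a}

/-! Availability provides solo executions: from the initial memory, a process updates to some `w ≠
⊥`, and the scan that follows returns exactly this update (`exists_update_scan`). Suppose that every
execution avoids the synchronization that the theorem predicts. Then an update by `p` and its scan
can be paused at a point where the memory still looks initial to another process `q`. There `q`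
performs its own solo update and scan, after which the paused run resumes as if nothing had
happened. One scan returns only the update of `p`, the other only that of `q`. In a sequential
history scans see prefixes, and a component that has been set stays different from `⊥`, so both
scans cannot occur (`false_of_scans`), against consistency.

The models differ in where the pause is. * SCM (`scm_interrupt`): before the first write. From then
on, read-before-write makes every read hit a variable that the run itself has written, so the writes
of `q` do not matter. * TSO (`tso_interrupt`): before the trailing fences. Leading fences meet an
empty buffer, and afterwards nothing forces the writes out of the buffer. * RA (`ra_interrupt`):
update and scan belong to different processes, and `q` is a third one. Leading fences happen while
the fence view is zero, a single message hands the view of the updater to the scanner, and the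
trailing fences of both wait until `q` is done. Thus `q` may use fences; it must be free of RMWs,
whose timestamps could collide with messages it has not seen.

`not_interruptible` and `not_interruptible_of_ne` turn these interleavings into contradictions. -/

theorem Run.append {S : LTS.{a, b} L} {q q' q'' : S.State} {π π' : List L}
    (h : S.Run q π q') (h' : S.Run q' π' q'') : S.Run q (π ++ π') q'' := by
  induction h with
  | nil => exact h'
  | cons hs _ ih => exact .cons hs (ih h')

theorem Run.exists_of_append {S : LTS.{a, b} L} {π π' : List L} {q q'' : S.State}
    (h : S.Run q (π ++ π') q'') : ∃ q', S.Run q π q' ∧ S.Run q' π' q'' := by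
  induction π generalizing q with
  | nil => exact ⟨q, .nil q, h⟩
  | cons l π ih =>
    cases h with
    | cons hs hr =>
      obtain ⟨q', h₁, h₂⟩ := ih hr
      exact ⟨q', .cons hs h₁, h₂⟩

theorem Run.eq_of_nil {S : LTS.{a, b} L} {q q' : S.State} (h : S.Run q [] q') : q = q' := by
  cases h
  rfl

theorem Run.exists_of_cons {S : LTS.{a, b} L} {l : L} {π : List L} {q q'' : S.State}
    (h : S.Run q (l :: π) q'') : ∃ q', S.Step q l q' ∧ S.Run q' π q'' := by
  cases h with
  | cons hs hr => exact ⟨_, hs, hr⟩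

/-- `S.ORun q σ q'`: some execution fragment from `q` to `q'` has the observable trace `σ`. -/
def ORun (S : LTS.{a, b} (Option L)) (q : S.State) (σ : List L) (q' : S.State) : Prop :=
  ∃ ρ, S.Run q ρ q' ∧ ρ.reduceOption = σ

theorem ORun.refl {S : LTS.{a, b} (Option L)} (q : S.State) : S.ORun q [] q :=
  ⟨[], .nil q, rfl⟩

theorem ORun.append {S : LTS.{a, b} (Option L)} {q q' q'' : S.State} {σ σ' : List L}
    (h : S.ORun q σ q') (h' : S.ORun q' σ' q'') : S.ORun q (σ ++ σ') q'' := by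
  obtain ⟨ρ, hr, rfl⟩ := h
  obtain ⟨ρ', hr', rfl⟩ := h'
  exact ⟨ρ ++ ρ', hr.append hr', List.reduceOption_append ρ ρ'⟩

theorem ORun.of_step {S : LTS.{a, b} (Option L)} {q q' : S.State} {e : L}
    (h : S.Step q (some e) q') : S.ORun q [e] q' :=
  ⟨[some e], .cons h (.nil _), rfl⟩

theorem ORun.of_tau {S : LTS.{a, b} (Option L)} {q q' : S.State}
    (h : S.Step q none q') : S.ORun q [] q' :=
  ⟨[none], .cons h (.nil _), rfl⟩

end LTS

section Memory
variable {N : ℕ} {Var : Type u} {Val : Type v}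

theorem LTS.ORun.mem_otraces {M : MemoryModel N Var Val} {σ : List (MemEv N Var Val)}
    {q : M.State} (h : M.ORun M.init σ q) : σ ∈ otraces M := by
  obtain ⟨ρ, hr, rfl⟩ := h
  exact ⟨ρ, ⟨q, hr⟩, rfl⟩

theorem HasRMW.mono {σ σ' : List (MemEv N Var Val)} (h : HasRMW σ) (hs : σ ⊆ σ') : HasRMW σ' := by
  obtain ⟨p, x, v, v', hm⟩ := h
  exact ⟨p, x, v, v', hs hm⟩

/-! ### Strongly consistent memory -/

/-- `SCMRun m σ m'`: strongly consistent memory leads from `m` to `m'` with the trace `σ`. -/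
def SCMRun (m : Var → Val) : List (MemEv N Var Val) → (Var → Val) → Prop
  | [], m' => m = m'
  | e :: σ, m' => ∃ m₁, SCMStep N Var Val m (some e) m₁ ∧ SCMRun m₁ σ m'

theorem SCMRun.append {σ σ' : List (MemEv N Var Val)} {m m' m'' : Var → Val}
    (h : SCMRun m σ m') (h' : SCMRun m' σ' m'') : SCMRun m (σ ++ σ') m'' := by
  induction σ generalizing m with
  | nil => cases h; exact h'
  | cons e σ ih =>
    obtain ⟨m₁, hs, hr⟩ := h
    exact ⟨m₁, hs, ih hr⟩

theorem SCMRun.exists_of_append {σ σ' : List (MemEv N Var Val)} {m m'' : Var → Val}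
    (h : SCMRun m (σ ++ σ') m'') : ∃ m', SCMRun m σ m' ∧ SCMRun m' σ' m'' := by
  induction σ generalizing m with
  | nil => exact ⟨m, rfl, h⟩
  | cons e σ ih =>
    obtain ⟨m₁, hs, hr⟩ := h
    obtain ⟨m', h₁, h₂⟩ := ih hr
    exact ⟨m', ⟨m₁, hs, h₁⟩, h₂⟩

theorem SCMRun.orun [Zero Val] {σ : List (MemEv N Var Val)} {m m' : Var → Val}
    (h : SCMRun m σ m') : (SCM N Var Val).ORun m σ m' := by
  induction σ generalizing m with
  | nil => cases h; exact .refl _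
  | cons e σ ih =>
    obtain ⟨m₁, hs, hr⟩ := h
    exact (LTS.ORun.of_step (S := SCM N Var Val) hs).append (ih hr)

theorem scmRun_of_run [Zero Val] {ρ : List (Option (MemEv N Var Val))}
    {m m' : (SCM N Var Val).State} (h : (SCM N Var Val).Run m ρ m') : SCMRun m ρ.reduceOption m' := by
  induction ρ generalizing m with
  | nil => cases h; rfl
  | cons l ρ ih =>
    cases h with
    | cons hs hr =>
      cases l with
      | none => exact nomatch (show SCMStep N Var Val _ _ _ from hs)
      | some e => exact ⟨_, hs, ih hr⟩

theorem exists_scmRun_of_mem_otraces [Zero Val] {σ : List (MemEv N Var Val)}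
    (h : σ ∈ otraces (SCM N Var Val)) : ∃ m', SCMRun (fun _ => 0) σ m' := by
  obtain ⟨ρ, ⟨q, hr⟩, rfl⟩ := h
  exact ⟨q, scmRun_of_run hr⟩

theorem SCMRun.eq_of_forall_not_write {σ : List (MemEv N Var Val)} {m m' : Var → Val}
    (h : SCMRun m σ m') (hr : ¬ HasRMW σ) (hw : ∀ p x v, (p, MemAct.W x v) ∉ σ) : m' = m := by
  induction σ generalizing m with
  | nil => exact h.symm
  | cons e σ ih =>
    obtain ⟨m₁, hs, hσ⟩ := h
    have h₁ := ih hσ (fun h => hr (h.mono (List.subset_cons_self _ _)))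
      (fun p x v h => hw p x v (List.mem_cons_of_mem _ h))
    cases hs with
    | write p x v => exact absurd List.mem_cons_self (hw p x v)
    | read => exact h₁
    | rmw p x v => exact absurd ⟨p, x, _, v, List.mem_cons_self⟩ hr
    | fence => exact h₁

/-- In a read-before-write sequence without RMWs, the part that starts with the first write
does not depend on the memory in which it runs. -/
theorem SCMRun.exists_of_isRBW {σ : List (MemEv N Var Val)} (hrbw : IsRBW σ) (hr : ¬ HasRMW σ)
    (pre suf : List (MemEv N Var Val)) (hσ : σ = pre ++ suf) (m₁ m₁' m₂ : Var → Val)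
    (hpre : (∃ p x v, (p, MemAct.W x v) ∈ pre) ∨ ∃ p x v, suf.head? = some (p, MemAct.W x v))
    (hag : ∀ p y v, (p, MemAct.W y v) ∈ pre → (∃ p' x' v', (p', MemAct.W x' v') ∈ pre) →
      m₁ y = m₂ y)
    (h : SCMRun m₁ suf m₁') : ∃ m₂', SCMRun m₂ suf m₂' := by
  -- `pre` is the part that has been executed. The invariant `hag` is that both memories agree on
  -- every variable written in `pre`; `hpre` ensures that any read in `suf` comes after some write.
  induction suf generalizing pre m₁ m₂ with
  | nil => exact ⟨m₂, rfl⟩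
  | cons e suf ih =>
    obtain ⟨m, hs, hsuf⟩ := h
    have hσ' : σ = (pre ++ [e]) ++ suf := by simp [hσ]
    cases hs with
    | write p x v =>
      classical
      have := ih (pre ++ [(p, .W x v)]) hσ' _ (Function.update m₂ x v)
        (.inl ⟨p, x, v, by simp⟩) ?_ hsuf
      · obtain ⟨m₂', h₂⟩ := this
        exact ⟨m₂', _, .write _ _ _ _, h₂⟩
      · intro p' y v' hm _
        rcases eq_or_ne y x with rfl | hne
        · simp
        · have hm' : (p', MemAct.W y v') ∈ pre := by simpa [hne] using hm
          simp only [Function.update_of_ne hne]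
          exact hag p' y v' hm' ⟨_, _, _, hm'⟩
    | read p x =>
      obtain ⟨p₁, x₁, v₁, hm₁⟩ : ∃ p x v, (p, MemAct.W x v) ∈ pre := by
        rcases hpre with h | ⟨_, _, _, h⟩
        · exact h
        · simp at h
      have hx : m₁ x = m₂ x := by
        by_cases hxx : x₁ = x
        · subst hxx
          exact hag p₁ x₁ v₁ hm₁ ⟨_, _, _, hm₁⟩
        -- The read is at position `pre.length`, after a write to another variable, so
        -- read-before-write puts a write to `x` into `pre`.
        · obtain ⟨k₁, hk₁, hget⟩ := List.mem_iff_getElem.mp hm₁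
          obtain ⟨k, p', v', -, hk, hkw⟩ := hrbw k₁ pre.length p₁ p x₁ x v₁ (m₁ x) hk₁
            (by simp [hσ, List.getElem?_append, hk₁, hget]) (by simp [hσ]) hxx
          have : (p', MemAct.W x v') ∈ pre := by
            rw [hσ, List.getElem?_append_left hk] at hkw
            exact List.mem_of_getElem? hkw
          exact hag p' x v' this ⟨_, _, _, this⟩
      obtain ⟨m₂', h₂⟩ := ih (pre ++ [(p, .R x (m₁ x))]) hσ' m₁ m₂
        (.inl ⟨p₁, x₁, v₁, by simp [hm₁]⟩) (by simpa using hag) hsuf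
      exact ⟨m₂', m₂, hx ▸ .read _ _ _, h₂⟩
    | rmw p x v => exact absurd ⟨p, x, m₁ x, v, by simp [hσ]⟩ hr
    | fence p =>
      obtain ⟨p₁, x₁, v₁, hm₁⟩ : ∃ p x v, (p, MemAct.W x v) ∈ pre := by
        rcases hpre with h | ⟨_, _, _, h⟩
        · exact h
        · simp at h
      obtain ⟨m₂', h₂⟩ := ih (pre ++ [(p, .F)]) hσ' m₁ m₂
        (.inl ⟨p₁, x₁, v₁, by simp [hm₁]⟩) (by simpa using hag) hsuf
      exact ⟨m₂', m₂, .fence _ _, h₂⟩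

/-- The cut is the point of interruption under SCM: the first part leaves the memory as it was, the
second starts with a write or is empty. -/
theorem exists_split_first_write (σ : List (MemEv N Var Val)) :
    ∃ σ₁ σ₂, σ = σ₁ ++ σ₂ ∧ (∀ p x v, (p, MemAct.W x v) ∉ σ₁) ∧
      (σ₂ = [] ∨ ∃ p x v, σ₂.head? = some (p, MemAct.W x v)) := by
  induction σ with
  | nil => exact ⟨[], [], rfl, by simp, .inl rfl⟩
  | cons e σ ih =>
    by_cases he : ∃ p x v, e = (p, MemAct.W x v)
    · obtain ⟨p, x, v, rfl⟩ := he
      exact ⟨[], _, rfl, by simp, .inr ⟨p, x, v, rfl⟩⟩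
    · obtain ⟨σ₁, σ₂, rfl, h₁, h₂⟩ := ih
      refine ⟨e :: σ₁, σ₂, rfl, ?_, h₂⟩
      intro p x v hm
      rcases List.mem_cons.mp hm with h | h
      · exact he ⟨p, x, v, h.symm⟩
      · exact h₁ p x v h

/-- A read-before-write run without RMWs can be interrupted, before its first write, by any
other run. -/
theorem scm_interrupt [Zero Val] {σ τ : List (MemEv N Var Val)} {m m' : Var → Val}
    (hrbw : IsRBW σ) (hr : ¬ HasRMW σ) (hσ : SCMRun (fun _ => 0) σ m)
    (hτ : SCMRun (fun _ => 0) τ m') :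
    ∃ σ₁ σ₂, σ = σ₁ ++ σ₂ ∧ σ₁ ++ τ ++ σ₂ ∈ otraces (SCM N Var Val) := by
  obtain ⟨σ₁, σ₂, rfl, hw, hh⟩ := exists_split_first_write σ
  refine ⟨σ₁, σ₂, rfl, ?_⟩
  obtain ⟨m₁, h₁, h₂⟩ := hσ.exists_of_append
  -- The memory is still `0` at the cut, so `τ` runs there unchanged.
  obtain rfl := h₁.eq_of_forall_not_write
    (fun h => hr (h.mono (List.subset_append_left _ _))) hw
  have : ∃ m'', SCMRun m' σ₂ m'' := by
    rcases hh with rfl | hh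
    · exact ⟨_, rfl⟩
    · exact SCMRun.exists_of_isRBW hrbw hr σ₁ σ₂ rfl _ _ _ (.inr hh)
        (fun p y v h => absurd h (hw p y v)) h₂
  obtain ⟨m'', h''⟩ := this
  exact ((h₁.append hτ).append h'').orun.mem_otraces

/-! ### Fences -/

theorem IsTF.exists_split {σ : List (MemEv N Var Val)} (h : IsTF σ) :
    ∃ σ₁ σ₂, σ = σ₁ ++ σ₂ ∧ (∀ e ∈ σ₁, e.2 ≠ .F) ∧ ∀ e ∈ σ₂, e.2 = .F := by
  induction σ with
  | nil => exact ⟨[], [], rfl, by simp, by simp⟩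
  | cons e σ ih =>
    have ht : IsTF σ := fun ⟨k, e₁, e₂, h₁, h₂, h'⟩ => h ⟨k + 1, e₁, e₂, by simpa, by simpa, h'⟩
    obtain ⟨σ₁, σ₂, rfl, hn, hf⟩ := ih ht
    by_cases he : e.2 = .F
    · cases σ₁ with
      | nil => exact ⟨[], e :: σ₂, rfl, by simp, by simpa [he] using hf⟩
      | cons e' σ₁ => exact absurd ⟨0, e, e', rfl, rfl, he, hn e' (by simp)⟩ h
    · exact ⟨e :: σ₁, σ₂, rfl, by simpa [he] using hn, hf⟩

theorem IsLF.exists_split {σ : List (MemEv N Var Val)} (h : IsLF σ) :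
    ∃ σ₁ σ₂, σ = σ₁ ++ σ₂ ∧ (∀ e ∈ σ₁, e.2 = .F) ∧ ∀ e ∈ σ₂, e.2 ≠ .F := by
  induction σ with
  | nil => exact ⟨[], [], rfl, by simp, by simp⟩
  | cons e σ ih =>
    have ht : IsLF σ := fun ⟨k, e₁, e₂, h₁, h₂, h'⟩ => h ⟨k + 1, e₁, e₂, by simpa, by simpa, h'⟩
    obtain ⟨σ₁, σ₂, rfl, hf, hn⟩ := ih ht
    by_cases he : e.2 = .F
    · exact ⟨e :: σ₁, σ₂, rfl, by simpa [he] using hf, hn⟩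
    · cases σ₁ with
      | nil => exact ⟨[], e :: σ₂, rfl, by simp, by simpa [he] using hn⟩
      | cons e' σ₁ => exact absurd ⟨0, e, e', rfl, rfl, he, hf e' (by simp)⟩ h

/-- The fence-free end of the leading-fence part and the fence-free start of the trailing-fence part
merge into one body. -/
theorem IsLTF.exists_split {σ : List (MemEv N Var Val)} (h : IsLTF σ) :
    ∃ σ₁ σ₂ σ₃, σ = σ₁ ++ σ₂ ++ σ₃ ∧ (∀ e ∈ σ₁, e.2 = .F) ∧ (∀ e ∈ σ₂, e.2 ≠ .F) ∧
      ∀ e ∈ σ₃, e.2 = .F := by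
  obtain ⟨_, _, rfl, hl, ht⟩ := h
  obtain ⟨a, b, rfl, ha, hb⟩ := hl.exists_split
  obtain ⟨c, d, rfl, hc, hd⟩ := ht.exists_split
  refine ⟨a, b ++ c, d, by simp, ha, ?_, hd⟩
  intro e he
  rcases List.mem_append.mp he with h | h
  exacts [hb e h, hc e h]

theorem SCMRun.eq_of_fences {σ : List (MemEv N Var Val)} {m m' : Var → Val} (h : SCMRun m σ m')
    (hf : ∀ e ∈ σ, e.2 = .F) : m' = m :=
  h.eq_of_forall_not_write (fun ⟨_, _, _, _, hm⟩ => nomatch hf _ hm)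
    (fun _ _ _ hm => nomatch hf _ hm)

theorem scmRun_fences {σ : List (MemEv N Var Val)} (m : Var → Val)
    (hf : ∀ e ∈ σ, e.2 = .F) : SCMRun m σ m := by
  induction σ with
  | nil => rfl
  | cons e σ ih =>
    obtain ⟨p, x⟩ := e
    obtain rfl : x = .F := hf (p, x) List.mem_cons_self
    exact ⟨m, .fence _ _, ih fun e he => hf e (List.mem_cons_of_mem _ he)⟩

/-! ### Total store order -/

open Classical in
/-- The memory that results from writing the entries of a store buffer to `m`. -/
noncomputable def applyBuf (m : Var → Val) (β : List (Var × Val)) : Var → Val :=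
  β.foldl (fun m e => Function.update m e.1 e.2) m

/-- The newest entry for `x` is the last one that the fold writes to `x`. Hence a TSO read returns
what the memory would hold after a flush of the reader's buffer. -/
theorem applyBuf_cases (m : Var → Val) (β : List (Var × Val)) (x : Var) :
    (bufRestrict β x = [] ∧ applyBuf m β x = m x) ∨
      (bufRestrict β x).getLast? = some (x, applyBuf m β x) := by
  classical
  induction β using List.reverseRecOn with
  | nil => exact .inl ⟨rfl, rfl⟩
  | append_singleton β e ih =>
    obtain ⟨y, v⟩ := e
    by_cases hy : y = x
    · subst hy
      exact .inr (by simp [bufRestrict, applyBuf])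
    · simpa [bufRestrict, applyBuf, hy, Function.update_of_ne (Ne.symm hy)] using ih

variable [Zero Val]

theorem tso_read {m : Var → Val} {b : Fin N → List (Var × Val)} (p : Fin N) (x : Var) :
    (TSO N Var Val).ORun ⟨m, b⟩ [(p, .R x (applyBuf m (b p) x))] ⟨m, b⟩ := by
  refine .of_step ?_
  rcases applyBuf_cases m (b p) x with ⟨h, h'⟩ | h
  · rw [h']
    exact TSOStep.readFromMemory m b p x h
  · exact TSOStep.readFromBuffer m b p x _ h

theorem tso_flush (m : Var → Val) (b : Fin N → List (Var × Val)) (p : Fin N) :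
    (TSO N Var Val).ORun ⟨m, b⟩ [] ⟨applyBuf m (b p), Function.update b p []⟩ := by
  generalize hβ : b p = β
  induction β generalizing m b with
  | nil =>
    rw [← hβ, Function.update_eq_self, hβ]
    exact .refl _
  | cons e β ih =>
    classical
    obtain ⟨x, v⟩ := e
    have h₁ : (TSO N Var Val).ORun ⟨m, b⟩ [] _ := .of_tau (TSOStep.propagate m b p x v β hβ)
    have h₂ := h₁.append (ih (Function.update m x v) (Function.update b p β) (by simp))
    rwa [Function.update_idem] at h₂

/-- Without fences and RMWs, a process can run with its writes staying in its buffer. -/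
theorem tso_run_buffered {p : Fin N} {σ : List (MemEv N Var Val)} {m m' m₀ : Var → Val}
    {b : Fin N → List (Var × Val)} (h : SCMRun m σ m') (hp : ∀ e ∈ σ, e.1 = p)
    (hr : ¬ HasRMW σ) (hf : ∀ e ∈ σ, e.2 ≠ .F) (hm : applyBuf m₀ (b p) = m) :
    ∃ b', (TSO N Var Val).ORun ⟨m₀, b⟩ σ ⟨m₀, b'⟩ ∧ ∀ q ≠ p, b' q = b q := by
  -- Invariant `hm`: the main memory `m₀` stays fixed, and applying the buffer of `p` to it gives
  -- the memory of the SCM run.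
  induction σ generalizing m b with
  | nil => exact ⟨b, .refl _, fun _ _ => rfl⟩
  | cons e σ ih =>
    obtain ⟨m₁, hs, hσ⟩ := h
    have ih' := fun b hm => ih (b := b) hσ (fun e he => hp e (List.mem_cons_of_mem _ he))
      (fun h => hr (h.mono (List.subset_cons_self _ _)))
      (fun e he => hf e (List.mem_cons_of_mem _ he)) hm
    have hep : e.1 = p := hp e List.mem_cons_self
    cases hs with
    | write q x v =>
      obtain rfl : q = p := hep
      obtain ⟨b', h', hq⟩ := ih' (Function.update b q (b q ++ [(x, v)]))
        (by simp [applyBuf, ← hm])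
      have h₁ : (TSO N Var Val).ORun ⟨m₀, b⟩ [(q, .W x v)] _ :=
        .of_step (TSOStep.write m₀ b q x v)
      exact ⟨b', h₁.append (by convert h'), fun r hr => by simp [hq r hr, hr]⟩
    | read q x =>
      obtain rfl : q = p := hep
      obtain ⟨b', h', hq⟩ := ih' b hm
      subst hm
      exact ⟨b', (tso_read q x).append h', hq⟩
    | rmw q x v => exact absurd ⟨q, x, _, v, List.mem_cons_self⟩ hr
    | fence q => exact absurd rfl (hf _ List.mem_cons_self)

/-- A process with an empty buffer can run as under strong consistency. -/
theorem tso_run_flushed {p : Fin N} {σ : List (MemEv N Var Val)} {m m' : Var → Val}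
    {b : Fin N → List (Var × Val)} (h : SCMRun m σ m') (hp : ∀ e ∈ σ, e.1 = p) (hb : b p = []) :
    (TSO N Var Val).ORun ⟨m, b⟩ σ ⟨m', b⟩ := by
  induction σ generalizing m with
  | nil => cases h; exact .refl _
  | cons e σ ih =>
    obtain ⟨m₁, hs, hσ⟩ := h
    have h' := ih hσ (fun e he => hp e (List.mem_cons_of_mem _ he))
    have hep : e.1 = p := hp e List.mem_cons_self
    cases hs with
    | write q x v =>
      obtain rfl : q = p := hep
      have h₁ : (TSO N Var Val).ORun ⟨m, b⟩ [(q, .W x v)] _ :=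
        .of_step (TSOStep.write m b q x v)
      -- Each write is flushed at once, so that the buffer is empty again and later fences and RMWs
      -- are enabled.
      have h₂ := tso_flush m (Function.update b q (b q ++ [(x, v)])) q
      rw [Function.update_self, Function.update_idem] at h₂
      classical
      have h₃ : applyBuf m (b q ++ [(x, v)]) = Function.update m x v := by simp [hb, applyBuf]
      have h₄ : Function.update b q [] = b := by rw [← hb, Function.update_eq_self]
      rw [h₃, h₄] at h₂
      exact (h₁.append h₂).append h'
    | read q x =>
      obtain rfl : q = p := hep
      have h₁ := tso_read (m := m) (b := b) q x
      rw [hb] at h₁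
      exact h₁.append h'
    | rmw q x v =>
      obtain rfl : q = p := hep
      have h₁ : (TSO N Var Val).ORun ⟨m, b⟩ [(q, .RMW x (m x) v)] _ :=
        .of_step (TSOStep.rmw m b q x v hb)
      exact h₁.append h'
    | fence q =>
      obtain rfl : q = p := hep
      have h₁ : (TSO N Var Val).ORun ⟨m, b⟩ [(q, .F)] _ :=
        .of_step (TSOStep.fence m b q hb)
      exact h₁.append h'

/-- A run without RMWs and middle fences can be interrupted, before its trailing fences, by any
run of another process. -/
theorem tso_interrupt {p q : Fin N} (hpq : p ≠ q) {σ τ : List (MemEv N Var Val)}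
    {m m' : Var → Val} (hltf : IsLTF σ) (hr : ¬ HasRMW σ) (hσ : SCMRun (fun _ => 0) σ m)
    (hp : ∀ e ∈ σ, e.1 = p) (hτ : SCMRun (fun _ => 0) τ m') (hq : ∀ e ∈ τ, e.1 = q) :
    ∃ σ₁ σ₂, σ = σ₁ ++ σ₂ ∧ σ₁ ++ τ ++ σ₂ ∈ otraces (TSO N Var Val) := by
  obtain ⟨σ₁, σ₂, σ₃, rfl, h₁, h₂, h₃⟩ := hltf.exists_split
  refine ⟨σ₁ ++ σ₂, σ₃, rfl, ?_⟩
  obtain ⟨_, hσ, -⟩ := hσ.exists_of_append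
  obtain ⟨m₁, hσ₁, hσ₂⟩ := hσ.exists_of_append
  obtain rfl := hσ₁.eq_of_fences h₁
  have r₁ := tso_run_flushed (b := fun _ => []) hσ₁ (p := p)
    (fun e he => hp e (by simp [he])) rfl
  obtain ⟨b, r₂, hb⟩ := tso_run_buffered (b := fun _ => []) hσ₂ (p := p)
    (m₀ := fun _ => 0) (fun e he => hp e (by simp [he]))
    (fun h => hr (h.mono fun e he => by simp [he])) h₂ rfl
  -- The writes of `p` are all in its buffer: `q` starts from the zero memory with an empty buffer.
  have r₃ := tso_run_flushed (b := b) hτ hq (hb q hpq.symm)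
  have r₄ := tso_flush m' b p
  -- `q` may have changed the memory, but only fences remain, and these run from any memory once the
  -- buffer of `p` is empty.
  have r₅ := tso_run_flushed (b := Function.update b p []) (p := p)
    (scmRun_fences (applyBuf m' (b p)) h₃) (fun e he => hp e (by simp [he])) (by simp)
  have r := (((r₁.append r₂).append r₃).append r₄).append r₅
  rw [List.append_nil] at r
  exact LTS.ORun.mem_otraces (M := TSO N Var Val) r

/-! ### Release/acquire -/

/-- The messages that process `p` reads in `st` carry the values of `m`. -/
def RASees (st : RAState N Var Val) (p : Fin N) (m : Var → Val) : Prop :=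
  ∀ x, ∃ V, (⟨x, m x, st.pview p x, V⟩ : Msg Var Val) ∈ st.mem

/-- The timestamps of each variable are bounded. -/
def RABounded (st : RAState N Var Val) : Prop :=
  ∀ x, ∃ B, ∀ μ ∈ st.mem, μ.var = x → μ.time ≤ B

/-- A run of a process that has no RMWs, and that has fences only if the process knows the fence
view, is possible from any state in which the process sees the initial memory of the run. -/
theorem ra_run {p : Fin N} {σ : List (MemEv N Var Val)} {m m' : Var → Val}
    {st : RAState N Var Val} (h : SCMRun m σ m') (hp : ∀ e ∈ σ, e.1 = p) (hr : ¬ HasRMW σ)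
    (hs : RASees st p m) (hb : RABounded st)
    (hf : (∃ e ∈ σ, e.2 = .F) → st.fview ≤ st.pview p) :
    ∃ st', (RA N Var Val).ORun st σ st' ∧ st.mem ⊆ st'.mem ∧
      (∀ q ≠ p, st'.pview q = st.pview q) ∧ RASees st' p m' ∧ RABounded st' ∧
      ((∀ e ∈ σ, e.2 ≠ .F) → st'.fview = st.fview) ∧ st.pview p ≤ st'.pview p ∧
      (st'.pview p = st.pview p ∨
        ∃ μ ∈ st'.mem, μ.view = st'.pview p ∧ st.pview p μ.var < μ.time) := by
  -- On the last disjunct: only writes change the view of `p` here, so the message of its last write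
  -- carries its whole view, and propagating that one message hands the view to another process.
  induction σ generalizing m st with
  | nil =>
    cases h
    exact ⟨st, .refl _, subset_rfl, fun _ _ => rfl, hs, hb, fun _ => rfl, le_rfl, .inl rfl⟩
  | cons e σ ih =>
    obtain ⟨m₁, hstep, hσ⟩ := h
    have ih' := fun st hs hb hf => ih (st := st) hσ (fun e he => hp e (List.mem_cons_of_mem _ he))
      (fun h => hr (h.mono (List.subset_cons_self _ _))) hs hb hf
    have hep : e.1 = p := hp e List.mem_cons_self
    cases hstep with
    | write q x v =>
      obtain rfl : q = p := hep
      obtain ⟨B, hB⟩ := hb x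
      classical
      -- Above `B` to be unused, above the view of `q` to be allowed.
      let t := max B (st.pview q x) + 1
      let V := Function.update (st.pview q) x t
      let st₁ : RAState N Var Val :=
        ⟨st.mem ∪ {⟨x, v, t, V⟩}, Function.update st.pview q V, st.fview⟩
      have hV : st₁.pview q = V := by simp [st₁]
      have hle : st.pview q ≤ V := by
        intro y
        rcases eq_or_ne y x with rfl | hy
        · simp only [V, t, Function.update_self]; omega
        · simp [V, hy]
      have hrun : (RA N Var Val).ORun st [(q, .W x v)] st₁ := by
        refine .of_step ?_
        refine RAStep.write st.mem st.pview st.fview q x v t (by omega) ?_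
        intro μ hμ hx
        have := hB μ hμ hx
        omega
      have := ih' st₁ ?_ ?_ ?_
      · obtain ⟨st', h₁, h₂, h₃, h₄, h₅, h₆, h₇, h₈⟩ := this
        refine ⟨st', hrun.append h₁, fun μ hμ => h₂ (.inl hμ), fun r hr => ?_, h₄, h₅,
          fun hn => h₆ fun e he => hn e (List.mem_cons_of_mem _ he), ?_, .inr ?_⟩
        · rw [h₃ r hr]
          simp [st₁, hr]
        · rw [hV] at h₇
          exact hle.trans h₇
        · rw [hV] at h₈
          -- Either this write is the last one that matters, or the rest of the run supplies a later
          -- message.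
          rcases h₈ with h₈ | ⟨μ, hμ, hμV, hlt⟩
          · exact ⟨⟨x, v, t, V⟩, h₂ (.inr rfl), h₈.symm, by simp only [t]; omega⟩
          · exact ⟨μ, hμ, hμV, (hle _).trans_lt hlt⟩
      · intro y
        rw [hV]
        rcases eq_or_ne y x with rfl | hy
        · exact ⟨V, .inr (by simp [V])⟩
        · obtain ⟨V', hV'⟩ := hs y
          exact ⟨V', .inl (by simpa [V, hy] using hV')⟩
      · intro y
        obtain ⟨B', hB'⟩ := hb y
        refine ⟨max B' t, ?_⟩
        rintro μ (hμ | rfl) hy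
        · exact (hB' μ hμ hy).trans (le_max_left _ _)
        · exact le_max_right _ _
      · rintro ⟨e, he, heF⟩
        rw [hV]
        exact (hf ⟨e, List.mem_cons_of_mem _ he, heF⟩).trans hle
    | read q x =>
      obtain rfl : q = p := hep
      obtain ⟨V, hV⟩ := hs x
      obtain ⟨st', h₁, h₂, h₃, h₄, h₅, h₆, h₇⟩ := ih' st hs hb
        fun ⟨e, he, h⟩ => hf ⟨e, List.mem_cons_of_mem _ he, h⟩
      have hrun : (RA N Var Val).ORun st [(q, .R x (m x))] st :=
        .of_step (RAStep.read st.mem st.pview st.fview q x (m x) V hV)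
      exact ⟨st', hrun.append h₁, h₂, h₃, h₄, h₅,
        fun hn => h₆ fun e he => hn e (List.mem_cons_of_mem _ he), h₇⟩
    -- An RMW would need the timestamp directly above the view of `q`, which an unseen message may
    -- occupy.
    | rmw q x v => exact absurd ⟨q, x, _, v, List.mem_cons_self⟩ hr
    | fence q =>
      obtain rfl : q = p := hep
      have hle := hf ⟨_, List.mem_cons_self, rfl⟩
      -- As the fence view is below the view of `q`, the fence only raises the fence view to the
      -- view of `q`; for later fences the two compare again.
      have hrun : (RA N Var Val).ORun st [(q, .F)] ⟨st.mem, st.pview, st.pview q⟩ := by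
        refine .of_step ?_
        have := RAStep.fence st.mem st.pview st.fview q
        rwa [sup_eq_left.mpr hle, Function.update_eq_self] at this
      obtain ⟨st', h₁, h₂, h₃, h₄, h₅, h₆, h₇⟩ := ih' ⟨st.mem, st.pview, st.pview q⟩ hs hb
        fun _ => le_rfl
      exact ⟨st', hrun.append h₁, h₂, h₃, h₄, h₅,
        fun hn => absurd rfl (hn _ List.mem_cons_self), h₇⟩

/-- RA fences are always enabled, so postponed trailing fences can run in whatever state is reached.
-/
theorem ra_run_fences {σ : List (MemEv N Var Val)} (hf : ∀ e ∈ σ, e.2 = .F)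
    (st : RAState N Var Val) : ∃ st', (RA N Var Val).ORun st σ st' := by
  induction σ generalizing st with
  | nil => exact ⟨st, .refl _⟩
  | cons e σ ih =>
    obtain ⟨p, x⟩ := e
    obtain rfl : x = .F := hf (p, x) List.mem_cons_self
    have hrun : (RA N Var Val).ORun st [(p, .F)] _ :=
      .of_step (RAStep.fence st.mem st.pview st.fview p)
    obtain ⟨st', h⟩ := ih (fun e he => hf e (List.mem_cons_of_mem _ he)) _
    exact ⟨st', hrun.append h⟩

/-- Fences of processes whose view is the fence view do nothing. -/
theorem ra_run_fences_of_eq {p : Fin N} {σ : List (MemEv N Var Val)} (hf : ∀ e ∈ σ, e.2 = .F)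
    (hp : ∀ e ∈ σ, e.1 = p) {st : RAState N Var Val} (h : st.pview p = st.fview) :
    (RA N Var Val).ORun st σ st := by
  induction σ with
  | nil => exact .refl _
  | cons e σ ih =>
    obtain ⟨q, x⟩ := e
    obtain rfl : x = .F := hf (q, x) List.mem_cons_self
    obtain rfl : q = p := hp (q, .F) List.mem_cons_self
    have hrun : (RA N Var Val).ORun st [(q, .F)] st := by
      refine .of_step ?_
      have := RAStep.fence st.mem st.pview st.fview q
      rwa [h, sup_idem, ← h, Function.update_eq_self, h] at this
    exact hrun.append (ih (fun e he => hf e (List.mem_cons_of_mem _ he))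
      fun e he => hp e (List.mem_cons_of_mem _ he))

/-- A run of `p` that is followed by a run of `q`, both without RMWs and middle fences, can be
interrupted by any RMW-free run of a third process, if the trailing fences of `p` and `q` are
postponed. -/
theorem ra_interrupt {p q r : Fin N} (hpq : p ≠ q) (hpr : p ≠ r) (hqr : q ≠ r)
    {σ σ' τ : List (MemEv N Var Val)} {m m' : Var → Val} (hltf : IsLTF σ) (hltf' : IsLTF σ')
    (hr : ¬ HasRMW σ) (hr' : ¬ HasRMW σ') (hrτ : ¬ HasRMW τ)
    (hσ : SCMRun (fun _ => 0) (σ ++ σ') m) (hp : ∀ e ∈ σ, e.1 = p) (hq : ∀ e ∈ σ', e.1 = q)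
    (hτ : SCMRun (fun _ => 0) τ m') (hτr : ∀ e ∈ τ, e.1 = r) :
    ∃ σ₁ σ₂ σ₁' σ₂', σ = σ₁ ++ σ₂ ∧ σ' = σ₁' ++ σ₂' ∧
      σ₁ ++ σ₁' ++ τ ++ σ₂ ++ σ₂' ∈ otraces (RA N Var Val) := by
  obtain ⟨σ₁, σ₂, σ₃, rfl, h₁, h₂, h₃⟩ := hltf.exists_split
  obtain ⟨σ₁', σ₂', σ₃', rfl, h₁', h₂', h₃'⟩ := hltf'.exists_split
  refine ⟨σ₁ ++ σ₂, σ₃, σ₁' ++ σ₂', σ₃', rfl, rfl, ?_⟩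
  obtain ⟨m₃, hσ, hσ'⟩ := hσ.exists_of_append
  obtain ⟨m₂, hσ, hσ₃⟩ := hσ.exists_of_append
  obtain rfl := hσ₃.eq_of_fences h₃
  obtain ⟨m₁, hσ₁, hσ₂⟩ := hσ.exists_of_append
  obtain rfl := hσ₁.eq_of_fences h₁
  obtain ⟨_, hσ', -⟩ := hσ'.exists_of_append
  obtain ⟨m₁', hσ₁', hσ₂'⟩ := hσ'.exists_of_append
  obtain rfl := hσ₁'.eq_of_fences h₁'
  let st₀ : RAState N Var Val := (RA N Var Val).init
  have r₁ : (RA N Var Val).ORun st₀ σ₁ st₀ :=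
    ra_run_fences_of_eq h₁ (p := p) (fun e he => hp e (by simp [he])) rfl
  have hsee : ∀ p, RASees st₀ p (fun _ => 0) := fun p x => ⟨fun _ => 0, rfl, rfl, rfl⟩
  obtain ⟨st₁, r₂, hmem₁, hother₁, hsee₁, hbdd₁, hfv₁, -, hlast⟩ :=
    ra_run hσ₂ (p := p) (fun e he => hp e (by simp [he]))
      (fun h => hr (h.mono fun e he => by simp [he])) (hsee p)
      (fun x => ⟨0, fun μ hμ _ => hμ.2.1.le⟩) (fun _ => le_rfl)
  replace hfv₁ := hfv₁ h₂
  -- The body of `p` has no fences, so the fence view is still zero, like the view of `q`: the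
  -- leading fences of `q` learn nothing. They must precede the propagation below, after which they
  -- could publish the view of `p`.
  have r₁' : (RA N Var Val).ORun st₁ σ₁' st₁ :=
    ra_run_fences_of_eq h₁' (p := q) (fun e he => hq e (by simp [he]))
      ((hother₁ q hpq.symm).trans hfv₁.symm)
  -- `q` catches up with `p` by at most one silent step. Its view is zero, so the join is exactly
  -- the view of the last message of `p`.
  obtain ⟨st₂, rτ, hmem₂, hother₂, hsee₂, hbdd₂, hfv₂⟩ : ∃ st₂, (RA N Var Val).ORun st₁ [] st₂ ∧
      st₂.mem = st₁.mem ∧ (∀ q' ≠ q, st₂.pview q' = st₁.pview q') ∧ RASees st₂ q m₁' ∧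
      RABounded st₂ ∧ st₂.fview = st₁.fview := by
    rcases hlast with hlast | ⟨μ, hμ, hμV, hlt⟩
    · refine ⟨st₁, .refl _, rfl, fun _ _ => rfl, fun x => ?_, hbdd₁, rfl⟩
      obtain ⟨V, hV⟩ := hsee₁ x
      rw [hlast] at hV
      refine ⟨V, ?_⟩
      rw [hother₁ q hpq.symm]
      exact hV
    · classical
      refine ⟨⟨st₁.mem, Function.update st₁.pview q (st₁.pview q ⊔ μ.view), st₁.fview⟩,
        .of_tau ?_, rfl, fun q' hq' => by simp [hq'], fun x => ?_, hbdd₁, rfl⟩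
      · have hlt' : st₁.pview q μ.var < μ.time := by
          rw [hother₁ q hpq.symm]
          exact hlt
        exact RAStep.propagate st₁.mem st₁.pview st₁.fview q μ hμ hlt'
      · obtain ⟨V, hV⟩ := hsee₁ x
        refine ⟨V, ?_⟩
        have h0 : st₁.pview q x = 0 := by
          rw [hother₁ q hpq.symm]
          rfl
        simpa [h0, hμV] using hV
  obtain ⟨st₃, r₂', hmem₃, hother₃, -, hbdd₃, hfv₃, -⟩ :=
    ra_run hσ₂' (p := q) (fun e he => hq e (by simp [he]))
      (fun h => hr' (h.mono fun e he => by simp [he])) hsee₂ hbdd₂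
      (fun ⟨e, he, h⟩ => absurd h (h₂' e he))
  -- The view of `r` and the fence view are still zero and the initial messages persist, so `r` sees
  -- the zero memory even if it uses fences.
  have hview : st₃.pview r = fun _ => 0 := by
    rw [hother₃ r hqr.symm, hother₂ r hqr.symm, hother₁ r hpr.symm]
    rfl
  have hfv : st₃.fview = fun _ => 0 := by
    rw [hfv₃ h₂', hfv₂, hfv₁]
    rfl
  obtain ⟨st₄, rt, -⟩ := ra_run hτ hτr hrτ (st := st₃)
    (fun x => by
      obtain ⟨V, hV⟩ := hsee r x
      refine ⟨V, ?_⟩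
      rw [hview]
      exact hmem₃ (hmem₂ ▸ hmem₁ hV)) hbdd₃ (fun _ => by rw [hview, hfv])
  obtain ⟨st₅, r₃⟩ := ra_run_fences h₃ st₄
  obtain ⟨st₆, r₃'⟩ := ra_run_fences h₃' st₅
  have r := (((r₁.append r₂).append (((r₁'.append rτ).append r₂'))).append rt).append
    r₃ |>.append r₃'
  rw [List.append_nil] at r
  exact LTS.ORun.mem_otraces (M := RA N Var Val) r

end Memory
/-! ### Histories -/

section Histories
variable {N : ℕ} {Op : Type a} {Ret : Type b}

/-- The concatenation of complete operations. -/
abbrev opHistories (l : List (Fin N × Op × Ret)) : List (ObjEv N Op Ret) :=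
  l.flatMap fun t => opHistory t.1 t.2.1 t.2.2

theorem getLast?_opHistories {l : List (Fin N × Op × Ret)} {e : ObjEv N Op Ret}
    (h : (opHistories l).getLast? = some e) : ∃ r, e.2 = .res r := by
  induction l using List.reverseRecOn with
  | nil => simp at h
  | append_singleton l t =>
    simp only [opHistories, opHistory, List.flatMap_append, List.flatMap_cons, List.flatMap_nil,
      List.append_nil, List.getLast?_append, List.getLast?_cons_cons, List.getLast?_singleton,
      Option.some_or, Option.some.injEq] at h
    exact ⟨t.2.2, by rw [← h]⟩

theorem isComplete_of_procRestrict {h : List (ObjEv N Op Ret)}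
    (hl : ∀ p, ∃ l, procRestrict h p = opHistories l) : IsComplete h := by
  refine ⟨fun p => ?_, fun p e he => ?_⟩
  · obtain ⟨l, hl⟩ := hl p
    exact ⟨l, hl ▸ List.prefix_refl _⟩
  · obtain ⟨l, hl⟩ := hl p
    exact getLast?_opHistories (hl ▸ he)

theorem procRestrict_opHistories (l : List (Fin N × Op × Ret)) (p : Fin N) :
    procRestrict (opHistories l) p = opHistories (l.filter fun t => t.1 = p) := by
  induction l with
  | nil => rfl
  | cons t l ih =>
    have : procRestrict (opHistories (t :: l)) p =
        procRestrict (opHistory t.1 t.2.1 t.2.2) p ++ procRestrict (opHistories l) p := by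
      simp [procRestrict]
    rw [this, ih]
    by_cases h : t.1 = p
    · simp only [procRestrict, opHistory, h, List.filter_cons, decide_true, if_true,
        List.filter_nil, opHistories, List.flatMap_cons]
    · simp [procRestrict, opHistory, h]

theorem isCompleteSequential_opHistories (l : List (Fin N × Op × Ret)) :
    IsCompleteSequential (opHistories l) :=
  ⟨isComplete_of_procRestrict fun p => ⟨_, procRestrict_opHistories l p⟩, l, List.prefix_refl _⟩

/-- A prefix that cuts a block in two ends with an invocation, which `hlast` excludes. -/
theorem exists_eq_opHistories_of_prefix {l : List (Fin N × Op × Ret)} {h : List (ObjEv N Op Ret)}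
    (hp : h <+: opHistories l) (hlast : ∀ e, h.getLast? = some e → ∃ r, e.2 = .res r) :
    ∃ l', h = opHistories l' := by
  induction l generalizing h with
  | nil => exact ⟨[], List.prefix_nil.mp hp⟩
  | cons t l ih =>
    have hp' : h <+: (t.1, .inv t.2.1) :: (t.1, .res t.2.2) :: opHistories l := by
      simpa [opHistories, opHistory] using hp
    match h, hp', hlast with
    | [], _, _ => exact ⟨[], rfl⟩
    | [e], hp', hlast =>
      obtain ⟨rfl, -⟩ := List.cons_prefix_cons.mp hp'
      obtain ⟨r, hr⟩ := hlast _ rfl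
      cases hr
    | e :: e' :: h, hp', hlast =>
      obtain ⟨rfl, hp₁⟩ := List.cons_prefix_cons.mp hp'
      obtain ⟨rfl, hp₂⟩ := List.cons_prefix_cons.mp hp₁
      obtain ⟨l', rfl⟩ := ih hp₂ fun e he => hlast e (by
        simp only [List.getLast?_cons, he, Option.getD_some])
      exact ⟨t :: l', by simp [opHistories, opHistory]⟩

theorem IsCompleteSequential.exists_eq_opHistories {h : List (ObjEv N Op Ret)}
    (hc : IsCompleteSequential h) : ∃ l, h = opHistories l := by
  obtain ⟨⟨-, hlast⟩, l, hl⟩ := hc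
  refine exists_eq_opHistories_of_prefix hl fun e he => hlast e.1 e ?_
  obtain ⟨ys, rfl⟩ := List.getLast?_eq_some_iff.mp he
  simp [procRestrict]

/-- The conflict between the two scans depends only on which events the linearized history contains,
so membership is what has to be transferred. -/
theorem IsReordering.mem_iff {X : Type c} {R : X → X → Prop} {s s' : List X}
    (h : IsReordering R s s') (x : X) : x ∈ s' ↔ x ∈ s := by
  obtain ⟨f, hf, -⟩ := h
  simp only [List.mem_iff_get]
  constructor
  · rintro ⟨i, rfl⟩
    exact ⟨f.symm i, by rw [hf, f.apply_symm_apply]⟩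
  · rintro ⟨i, rfl⟩
    exact ⟨f i, (hf i).symm⟩

end Histories

/-! ### Executions of an implementation -/

namespace Implementation
variable {N : ℕ} {Var : Type u} {Val : Type v} {O : Obj.{a, b} N}

/-- Process `p` can execute `o` with the memory events `ms` and the response `r`. -/
def OpExec (I : Implementation.{a, b, u, v, s} Var Val O) (p : Fin N)
    (t : O.Op × O.Ret × List (MemEv N Var Val)) : Prop :=
  t.2.2.map Event.mem ++ [Event.obj (p, .res t.2.1)] ∈ (I t.1 p).traces

/-- The events of an execution of an operation by `p`. -/
def opTrace (p : Fin N) (t : O.Op × O.Ret × List (MemEv N Var Val)) :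
    List (Event N Var Val O.Op O.Ret) :=
  .obj (p, .inv t.1) :: (t.2.2.map Event.mem ++ [.obj (p, .res t.2.1)])

theorem memPart_append (π π' : List (Event N Var Val O.Op O.Ret)) :
    memPart (π ++ π') = memPart π ++ memPart π' :=
  List.filterMap_append

theorem objPart_append (π π' : List (Event N Var Val O.Op O.Ret)) :
    objPart (π ++ π') = objPart π ++ objPart π' :=
  List.filterMap_append

theorem memPart_map_mem (ms : List (MemEv N Var Val)) :
    memPart (ms.map Event.mem : List (Event N Var Val O.Op O.Ret)) = ms := by
  induction ms with
  | nil => rfl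
  | cons e ms ih => exact congrArg (e :: ·) ih

theorem objPart_map_mem (ms : List (MemEv N Var Val)) :
    objPart (ms.map Event.mem : List (Event N Var Val O.Op O.Ret)) = [] := by
  induction ms with
  | nil => rfl
  | cons e ms ih => exact ih

theorem memPart_map_mem_append_obj (ms : List (MemEv N Var Val)) (e : ObjEv N O.Op O.Ret) :
    memPart (ms.map Event.mem ++ [.obj e] : List (Event N Var Val O.Op O.Ret)) = ms := by
  rw [memPart_append, memPart_map_mem]
  exact List.append_nil ms

theorem memPart_opTrace (p : Fin N) (t : O.Op × O.Ret × List (MemEv N Var Val)) :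
    memPart (opTrace p t) = t.2.2 :=
  memPart_map_mem_append_obj t.2.2 (p, .res t.2.1)

theorem objPart_opTrace (p : Fin N) (t : O.Op × O.Ret × List (MemEv N Var Val)) :
    objPart (opTrace p t) = opHistory p t.1 t.2.1 := by
  change (p, ObjAct.inv t.1) :: objPart (t.2.2.map Event.mem ++ [.obj (p, .res t.2.1)]) = _
  rw [objPart_append, objPart_map_mem]
  rfl

theorem proc_of_mem_run {I : Implementation.{a, b, u, v, s} Var Val O} {o : O.Op} {p : Fin N}
    {q q' : (I o p).State} {π : List (Event N Var Val O.Op O.Ret)}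
    (h : (I o p).Run q π q') : ∀ e ∈ π, e.proc = p := by
  induction h with
  | nil => simp
  | cons hs _ ih =>
    intro e he
    rcases List.mem_cons.mp he with rfl | he
    exacts [(I o p).proc_eq _ _ _ hs, ih e he]

theorem OpExec.proc_mem {I : Implementation.{a, b, u, v, s} Var Val O} {p : Fin N}
    {t : O.Op × O.Ret × List (MemEv N Var Val)} (h : I.OpExec p t) : ∀ e ∈ t.2.2, e.1 = p := by
  obtain ⟨q, h⟩ := h
  exact fun e he => proc_of_mem_run h (.mem e) (by simp [he])

theorem OpExec.proc_opTrace {I : Implementation.{a, b, u, v, s} Var Val O} {p : Fin N}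
    {t : O.Op × O.Ret × List (MemEv N Var Val)} (h : I.OpExec p t) :
    ∀ e ∈ opTrace p t, e.proc = p := by
  obtain ⟨q, h⟩ := h
  intro e he
  rcases List.mem_cons.mp he with rfl | he
  exacts [rfl, proc_of_mem_run h e he]

theorem procStep_none {I : Implementation.{a, b, u, v, s} Var Val O} {p : Fin N}
    {e : Event N Var Val O.Op O.Ret} {s' : I.ProcState p} (h : I.ProcStep p none e s') :
    ∃ o, e = .obj (p, .inv o) ∧ s' = some ⟨o, (I o p).init⟩ := by
  cases h with
  | invoke o => exact ⟨o, rfl, rfl⟩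

theorem procStep_some {I : Implementation.{a, b, u, v, s} Var Val O} {p : Fin N} {o : O.Op}
    {q : (I o p).State} {e : Event N Var Val O.Op O.Ret} {s' : I.ProcState p}
    (h : I.ProcStep p (some ⟨o, q⟩) e s') :
    ∃ q', (I o p).Step q e q' ∧
      ((∃ e', e = .mem e' ∧ s' = some ⟨o, q'⟩) ∨ ∃ r, e = .obj (p, .res r) ∧ s' = none) := by
  cases h with
  | memory _ _ q' e' h => exact ⟨q', h, .inl ⟨e', rfl, rfl⟩⟩
  | respond _ _ q' r h => exact ⟨q', h, .inr ⟨r, rfl, rfl⟩⟩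

/-- All other processes are idle, so the first step of any of them is an invocation. It would be an
object event before the response of `p`; hence `p` runs alone until it responds. -/
theorem exists_of_run_update {I : Implementation.{a, b, u, v, s} Var Val O} {p : Fin N} {o : O.Op}
    {q₀ : (I o p).State} {r : O.Ret} {h : List (ObjEv N O.Op O.Ret)} {q : I.sys.State}
    {π : List (Event N Var Val O.Op O.Ret)}
    (hrun : I.sys.Run (Function.update (fun _ => none : ∀ p, I.ProcState p) p (some ⟨o, q₀⟩)) π q)
    (hobj : objPart π = (p, .res r) :: h) :
    ∃ (ms : List (MemEv N Var Val)) (π' : List (Event N Var Val O.Op O.Ret)) (q₁ : (I o p).State),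
      π = ms.map Event.mem ++ [.obj (p, .res r)] ++ π' ∧
      (I o p).Run q₀ (ms.map Event.mem ++ [.obj (p, .res r)]) q₁ ∧ I.sys.Run I.sys.init π' q := by
  induction π generalizing q₀ with
  | nil => cases hobj
  | cons e π ih =>
    obtain ⟨_, ⟨p', s', hs, rfl⟩, hr⟩ := hrun.exists_of_cons
    rcases eq_or_ne p' p with rfl | hp
    · rw [Function.update_self] at hs
      rw [Function.update_idem] at hr
      obtain ⟨q', hq', ⟨e', rfl, rfl⟩ | ⟨r', rfl, rfl⟩⟩ := procStep_some hs
      · obtain ⟨ms, π', q₁, rfl, h₁, h₂⟩ := ih hr hobj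
        exact ⟨e' :: ms, π', q₁, rfl, .cons hq' h₁, h₂⟩
      · obtain rfl : r' = r := ObjAct.res.inj (Prod.mk.inj (List.cons.inj hobj).1).2
        refine ⟨[], π, q', rfl, .cons hq' (.nil _), ?_⟩
        have h₀ : Function.update (fun _ => none : ∀ p, I.ProcState p) p' none = fun _ => none :=
          Function.update_eq_self (f := (fun _ => none : ∀ p, I.ProcState p)) p'
        rw [h₀] at hr
        exact hr
    · rw [Function.update_of_ne hp] at hs
      obtain ⟨o', rfl, -⟩ := procStep_none hs
      exact absurd (Prod.mk.inj (List.cons.inj hobj).1).1 hp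

theorem exists_opExec_of_run {I : Implementation.{a, b, u, v, s} Var Val O} {p : Fin N} {o : O.Op}
    {r : O.Ret} {h : List (ObjEv N O.Op O.Ret)} {q : I.sys.State}
    {π : List (Event N Var Val O.Op O.Ret)} (hrun : I.sys.Run I.sys.init π q)
    (hobj : objPart π = opHistory p o r ++ h) :
    ∃ ms π', π = opTrace p (o, r, ms) ++ π' ∧ I.OpExec p (o, r, ms) ∧
      I.sys.Run I.sys.init π' q ∧ objPart π' = h := by
  cases hrun with
  | nil => cases hobj
  | @cons _ _ _ _ π hs hr =>
    obtain ⟨p', s', hs, rfl⟩ := hs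
    obtain ⟨o', rfl, rfl⟩ := procStep_none hs
    obtain ⟨h₁, h₂⟩ := List.cons.inj hobj
    obtain ⟨rfl, ho⟩ := Prod.mk.inj h₁
    obtain rfl := ObjAct.inv.inj ho
    obtain ⟨ms, π', q₁, rfl, h₃, h₄⟩ := exists_of_run_update hr (r := r) (h := h) h₂
    refine ⟨ms, π', rfl, ⟨q₁, h₃⟩, h₄, ?_⟩
    change objPart _ = _ at h₂
    rw [List.append_assoc, objPart_append, objPart_map_mem] at h₂
    exact (List.cons.inj h₂).2

/-- The LTS of a single process. -/
abbrev procLTS (I : Implementation.{a, b, u, v, s} Var Val O) (p : Fin N) :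
    LTS (Event N Var Val O.Op O.Ret) where
  State := I.ProcState p
  init := none
  Step := I.ProcStep p

/-- In `sys` the processes share no state, the memory being a separate system, so any interleaving
of runs of the processes is a run. -/
theorem sys_run_of_procLTS_run {I : Implementation.{a, b, u, v, s} Var Val O}
    {π : List (Event N Var Val O.Op O.Ret)} {q q' : ∀ p, I.ProcState p}
    (h : ∀ p, (I.procLTS p).Run (q p) (π.filter fun e => e.proc = p) (q' p)) :
    I.sys.Run q π q' := by
  induction π generalizing q with
  | nil =>
    obtain rfl : q = q' := funext fun p => (h p).eq_of_nil
    exact LTS.Run.nil (S := I.sys) q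
  | cons e π ih =>
    have he := h e.proc
    rw [List.filter_cons_of_pos (by simp)] at he
    obtain ⟨(s' : I.ProcState e.proc), hs, hr⟩ := he.exists_of_cons
    refine .cons (q' := Function.update q e.proc s') ⟨e.proc, s', hs, rfl⟩ (ih fun p => ?_)
    rcases eq_or_ne p e.proc with rfl | hp
    · rw [Function.update_self]
      exact hr
    · have := h p
      rw [List.filter_cons_of_neg (by simpa using hp.symm)] at this
      rwa [Function.update_of_ne hp]

theorem procLTS_run_of_run {I : Implementation.{a, b, u, v, s} Var Val O} {p : Fin N} {o : O.Op}
    {r : O.Ret} {ms : List (MemEv N Var Val)} {q q' : (I o p).State}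
    (h : (I o p).Run q (ms.map Event.mem ++ [.obj (p, .res r)]) q') :
    (I.procLTS p).Run (some ⟨o, q⟩ : I.ProcState p)
      (ms.map Event.mem ++ [.obj (p, .res r)]) (none : I.ProcState p) := by
  induction ms generalizing q with
  | nil =>
    cases h with
    | cons hs _ => exact .cons (ProcStep.respond o _ _ r hs) (.nil _)
  | cons e ms ih =>
    cases h with
    | cons hs hr => exact .cons (ProcStep.memory o _ _ e hs) (ih hr)

/-- Every operation starts from its initial state and ends in the idle state, so executions can be
chained freely. -/
theorem OpExec.procLTS_run {I : Implementation.{a, b, u, v, s} Var Val O} {p : Fin N}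
    {l : List (O.Op × O.Ret × List (MemEv N Var Val))} (h : ∀ t ∈ l, I.OpExec p t) :
    (I.procLTS p).Run (I.procLTS p).init (l.flatMap (opTrace p)) (I.procLTS p).init := by
  induction l with
  | nil => exact .nil _
  | cons t l ih =>
    obtain ⟨q, hq⟩ := h t List.mem_cons_self
    exact (LTS.Run.cons (ProcStep.invoke t.1) (procLTS_run_of_run hq)).append
      (ih fun t ht => h t (List.mem_cons_of_mem _ ht))

theorem procRestrict_objPart (π : List (Event N Var Val O.Op O.Ret)) (p : Fin N) :
    procRestrict (objPart π) p = objPart (π.filter fun e => e.proc = p) := by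
  induction π with
  | nil => rfl
  | cons e π ih =>
    cases e with
    | mem e =>
      by_cases h : e.1 = p
      · rw [List.filter_cons_of_pos (by simp [Event.proc, h])]
        exact ih
      · rw [List.filter_cons_of_neg (by simp [Event.proc, h])]
        exact ih
    | obj e =>
      change List.filter _ (e :: objPart π) = _
      by_cases h : e.1 = p
      · rw [List.filter_cons_of_pos (by simp [h]),
          List.filter_cons_of_pos (by simp [Event.proc, h])]
        exact congrArg (e :: ·) ih
      · rw [List.filter_cons_of_neg (by simp [h]),
          List.filter_cons_of_neg (by simp [Event.proc, h])]
        exact ih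

/-- If the projections of `π` to the processes are concatenations of executions of operations,
and the memory allows `π`, then a history of the specification has the same events as `π`. -/
theorem Consistent.exists_spec {I : Implementation.{a, b, u, v, s} Var Val O}
    {M : MemoryModel N Var Val} (hcons : I.Consistent M)
    (l : Fin N → List (O.Op × O.Ret × List (MemEv N Var Val)))
    (hl : ∀ p, ∀ t ∈ l p, I.OpExec p t) {π : List (Event N Var Val O.Op O.Ret)}
    (hπ : ∀ p, (π.filter fun e => e.proc = p) = (l p).flatMap (opTrace p))
    (hM : memPart π ∈ otraces M) :
    ∃ h ∈ O.Spec, ∀ e, e ∈ h ↔ ∃ t ∈ l e.1, e.2 = .inv t.1 ∨ e.2 = .res t.2.1 := by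
  have hproc : ∀ p, procRestrict (objPart π) p =
      opHistories ((l p).map fun t => (p, t.1, t.2.1)) := by
    intro p
    rw [procRestrict_objPart, hπ]
    generalize l p = l
    induction l with
    | nil => rfl
    | cons t l ih =>
      rw [List.flatMap_cons]
      rw [objPart_append, ih, objPart_opTrace]
      rfl
  have hrun : π ∈ I.sys.traces :=
    ⟨I.sys.init, sys_run_of_procLTS_run fun p => by
      rw [hπ]
      exact OpExec.procLTS_run (hl p)⟩
  obtain ⟨h, hh, -, -, hre⟩ := hcons (objPart π) ⟨π, rfl, hrun, hM⟩
    (isComplete_of_procRestrict fun p => ⟨_, hproc p⟩)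
  refine ⟨h, hh, fun e => ?_⟩
  have : e ∈ objPart π ↔ e ∈ procRestrict (objPart π) e.1 := by simp [procRestrict]
  rw [hre.mem_iff, this, hproc]
  obtain ⟨p, x⟩ := e
  simp [opHistory]

theorem filter_proc_eq {π : List (Event N Var Val O.Op O.Ret)} {q : Fin N}
    (h : ∀ e ∈ π, e.proc = q) (p : Fin N) :
    (π.filter fun e => e.proc = p) = if p = q then π else [] := by
  split_ifs with hp
  · exact List.filter_eq_self.mpr fun e he => by simp [h e he, hp]
  · exact List.filter_eq_nil_iff.mpr fun e he => by simp [h e he, Ne.symm hp]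

end Implementation

/-! ### The snapshot object -/

section Snapshot
variable {N : ℕ} {W : Type w} {A : Set W}

theorem exists_update_of_snapState_ne {x : Fin N → W}
    {h : List (ObjEv N (SnapOp A) (SnapRet N W))} {i : Fin N} (hs : snapState x h i ≠ x i) :
    ∃ y, (i, ObjAct.inv (SnapOp.update y)) ∈ h := by
  induction h generalizing x with
  | nil => exact absurd rfl hs
  | cons e h ih =>
    obtain ⟨p, (y | _) | r⟩ := e
    · by_cases hp : i = p
      · exact ⟨y, by simp [hp]⟩
      · obtain ⟨y', hy'⟩ := ih (x := Function.update x p y) (by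
          simpa [snapState, hp] using hs)
        exact ⟨y', List.mem_cons_of_mem _ hy'⟩
    all_goals
      obtain ⟨y', hy'⟩ := ih (x := x) (by simpa [snapState] using hs)
      exact ⟨y', List.mem_cons_of_mem _ hy'⟩

variable [Bot W]

/-- Later updates may overwrite a component, but by `hA` never with `⊥`. -/
theorem snapState_ne_bot {x : Fin N → W} {h : List (ObjEv N (SnapOp A) (SnapRet N W))} {i : Fin N}
    (hA : ∀ p y, (p, ObjAct.inv (SnapOp.update y)) ∈ h → (y : W) ≠ ⊥)
    (hi : x i ≠ ⊥ ∨ ∃ y, (i, ObjAct.inv (SnapOp.update y)) ∈ h) : snapState x h i ≠ ⊥ := by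
  induction h generalizing x with
  | nil => simpa [snapState] using hi
  | cons e h ih =>
    have ih' := fun x => ih (x := x) fun p y hy => hA p y (List.mem_cons_of_mem _ hy)
    obtain ⟨p, (y | _) | r⟩ := e
    · refine ih' _ ?_
      by_cases hp : i = p
      · subst hp
        exact .inl (by simpa using hA i y List.mem_cons_self)
      · simpa [hp] using hi
    all_goals exact ih' x (by simpa using hi)

theorem exists_eq_append_of_mem_spec {h : List (ObjEv N (SnapOp A) (SnapRet N W))}
    (hh : h ∈ (snapshot N A).Spec) {p : Fin N} {x : Fin N → W}
    (hx : (p, ObjAct.res (SnapRet.vec x)) ∈ h) :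
    ∃ h', h' <+: h ∧ x = snapState (fun _ => ⊥) h' := by
  obtain ⟨hc, hs⟩ := hh
  obtain ⟨l, rfl⟩ := hc.exists_eq_opHistories
  obtain ⟨o, ho⟩ : ∃ o, (p, o, SnapRet.vec x) ∈ l := by
    simp only [opHistories, opHistory, List.mem_flatMap, List.mem_cons, List.not_mem_nil,
      or_false, Prod.mk.injEq, reduceCtorEq, and_false, false_or, ObjAct.res.injEq] at hx
    obtain ⟨⟨p', o, r⟩, ht, rfl, rfl⟩ := hx
    exact ⟨o, ht⟩
  obtain ⟨l₁, l₂, rfl⟩ := List.append_of_mem ho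
  have := hs (opHistories l₁) p o (.vec x) (opHistories l₂) (by simp [opHistories])
  refine ⟨opHistories l₁, by simp [opHistories], ?_⟩
  cases o with
  | update y => cases this
  | scan => exact SnapRet.vec.inj this

/-- Scans are totally ordered: no two of them miss each a component that the other has. -/
theorem scans_comparable {h : List (ObjEv N (SnapOp A) (SnapRet N W))}
    (hh : h ∈ (snapshot N A).Spec)
    (hA : ∀ p y, (p, ObjAct.inv (SnapOp.update y)) ∈ h → (y : W) ≠ ⊥)
    {p p' i j : Fin N} {x x' : Fin N → W} (hx : (p, ObjAct.res (SnapRet.vec x)) ∈ h)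
    (hx' : (p', ObjAct.res (SnapRet.vec x')) ∈ h) (hi : x i ≠ ⊥) (hj : x j = ⊥)
    (hi' : x' i = ⊥) (hj' : x' j ≠ ⊥) : False := by
  obtain ⟨h₁, hp₁, rfl⟩ := exists_eq_append_of_mem_spec hh hx
  obtain ⟨h₂, hp₂, rfl⟩ := exists_eq_append_of_mem_spec hh hx'
  obtain ⟨y, hy⟩ := exists_update_of_snapState_ne hi
  obtain ⟨y', hy'⟩ := exists_update_of_snapState_ne hj'
  -- The prefixes seen by the scans are nested, and the longer one keeps every component that the
  -- shorter one has set.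
  rcases List.prefix_or_prefix_of_prefix hp₁ hp₂ with h | h
  · exact snapState_ne_bot (fun p y hy => hA p y (hp₂.subset hy)) (.inr ⟨y, h.subset hy⟩) hi'
  · exact snapState_ne_bot (fun p y hy => hA p y (hp₁.subset hy)) (.inr ⟨y', h.subset hy'⟩) hj

theorem update_scan_mem_spec (w : A) (p p' : Fin N) :
    opHistory p (SnapOp.update w) SnapRet.ack ++
      opHistory p' SnapOp.scan (.vec (Function.update (fun _ => ⊥) p (w : W))) ∈
        (snapshot N A).Spec := by
  refine ⟨isCompleteSequential_opHistories [(p, SnapOp.update w, SnapRet.ack),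
    (p', SnapOp.scan, .vec (Function.update (fun _ => ⊥) p (w : W)))], ?_⟩
  intro h₁ q (o : SnapOp A) (r : SnapRet N W) h₂ h
  -- The history has four events, so a block can start only at position 0 or 2; elsewhere the kinds
  -- of events or the length do not fit.
  match h₁, h with
  | [], h =>
    obtain ⟨hi, hr⟩ := List.cons.inj h
    obtain rfl : SnapOp.update w = o := ObjAct.inv.inj (Prod.mk.inj hi).2
    exact (ObjAct.res.inj (Prod.mk.inj (List.cons.inj hr).1).2).symm
  | [e], h => exact nomatch (Prod.mk.inj (List.cons.inj (List.cons.inj h).2).1).2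
  | [e, e'], h =>
    obtain ⟨rfl, h'⟩ := List.cons.inj h
    obtain ⟨rfl, h''⟩ := List.cons.inj h'
    obtain ⟨hi, hr⟩ := List.cons.inj h''
    obtain rfl : SnapOp.scan = o := ObjAct.inv.inj (Prod.mk.inj hi).2
    exact (ObjAct.res.inj (Prod.mk.inj (List.cons.inj hr).1).2).symm
  | [e, e', e''], h =>
    exact nomatch (List.cons.inj (List.cons.inj (List.cons.inj (List.cons.inj h).2).2).2).2
  | e :: e' :: e'' :: e''' :: h₁, h =>
    have := (List.cons.inj (List.cons.inj (List.cons.inj (List.cons.inj h).2).2).2).2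
    cases h₁ <;> exact nomatch this

end Snapshot

/-! ### Solo executions, their forbidden interleavings, and the theorem -/

section Main
variable {N : ℕ} {Var : Type u} {Val : Type v} {W : Type w} {A : Set W} [Bot W]
  {I : Implementation.{w, w, u, v, s} Var Val (snapshot N A)}

open Implementation

/-- An execution of `update w` by `p`, with the memory events `ms`. -/
def UpdateExec (I : Implementation.{w, w, u, v, s} Var Val (snapshot N A)) (p : Fin N) (w : A)
    (ms : List (MemEv N Var Val)) : Prop :=
  I.OpExec p (SnapOp.update w, SnapRet.ack, ms)

/-- An execution of a scan by `p'`, with the memory events `ms`, that returns the vector whose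
only component other than `⊥` is `w` at `p`. -/
def ScanExec (I : Implementation.{w, w, u, v, s} Var Val (snapshot N A)) (p' p : Fin N) (w : A)
    (ms : List (MemEv N Var Val)) : Prop :=
  I.OpExec p' (SnapOp.scan, SnapRet.vec (Function.update (fun _ => ⊥) p (w : W)), ms)

/-- Availability after the empty trace. The history is sequential, so the trace falls apart into the
two executions. The processes may coincide, as they do under SCM and TSO. -/
theorem exists_update_scan [Zero Val] (havail : I.SpecAvailable) (w : A) (p p' : Fin N) :
    ∃ ms ms' m, UpdateExec I p w ms ∧ ScanExec I p' p w ms' ∧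
      SCMRun (fun _ => 0) (ms ++ ms') m := by
  have hspec := update_scan_mem_spec w p p'
  obtain ⟨π, hobj, ⟨q, hrun⟩, hM⟩ := havail [] _ (isCompleteSequential_opHistories [])
    hspec.1 hspec [] ⟨_, .nil _⟩ ⟨[], ⟨_, .nil _⟩, rfl⟩ rfl
  obtain ⟨ms, π', rfl, h₁, hrun, hobj⟩ := exists_opExec_of_run hrun hobj.symm
  obtain ⟨ms', π'', rfl, h₂, hrun, hobj⟩ := exists_opExec_of_run hrun
    (hobj.trans (List.append_nil _).symm)
  -- All processes are idle and no object event is left, but an idle process can only invoke.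
  obtain rfl : π'' = [] := by
    cases hrun with
    | nil => rfl
    | cons hs =>
      obtain ⟨p', s', hs, rfl⟩ := hs
      obtain ⟨o', rfl, rfl⟩ := procStep_none hs
      cases hobj
  obtain ⟨m, hm⟩ := exists_scmRun_of_mem_otraces hM
  refine ⟨ms, ms', m, h₁, h₂, ?_⟩
  have hmem : memPart (opTrace p (O := snapshot N A) (SnapOp.update w, SnapRet.ack, ms) ++
      (opTrace p' (O := snapshot N A)
        (SnapOp.scan, SnapRet.vec (Function.update (fun _ => ⊥) p (w : W)), ms') ++ [])) =
      ms ++ ms' := by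
    rw [List.append_nil, memPart_append]
    exact congrArg₂ _ (memPart_opTrace _ _) (memPart_opTrace _ _)
  exact hmem ▸ hm

/-- A scan that returns only the update of `p` and a scan that returns only the update of `p'`
cannot occur in one history of the specification. -/
theorem false_of_scans {h : List (ObjEv N (SnapOp A) (SnapRet N W))} {w : A} (hw : (w : W) ≠ ⊥)
    (hh : h ∈ (snapshot N A).Spec)
    (hA : ∀ q y, (q, ObjAct.inv (SnapOp.update y)) ∈ h → y = w) {p p' q q' : Fin N} (hp : p ≠ p')
    (hx : (q, ObjAct.res (SnapRet.vec (Function.update (fun _ => ⊥) p (w : W)))) ∈ h)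
    (hx' : (q', ObjAct.res (SnapRet.vec (Function.update (fun _ => ⊥) p' (w : W)))) ∈ h) :
    False :=
  scans_comparable hh (fun q y hy => hA q y hy ▸ hw) hx hx' (i := p) (j := p') (by simpa)
    (by simp [hp.symm]) (by simp [hp]) (by simpa)

/-- The interleaving projects to complete executions of `p` and of `q`, so it is a trace of the
system, and its history contains two incomparable scans. The cut may fall inside the update or
inside the scan, hence the form of `hσ`. -/
theorem not_interruptible {M : MemoryModel N Var Val} (hcons : I.Consistent M) {w : A}
    (hw : (w : W) ≠ ⊥) {p q : Fin N} (hpq : p ≠ q) {a b c d σ₁ σ₂ : List (MemEv N Var Val)}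
    (ha : UpdateExec I q w a) (hb : ScanExec I q q w b) (hc : UpdateExec I p w c)
    (hd : ScanExec I p p w d) (hσ : c ++ d = σ₁ ++ σ₂) :
    σ₁ ++ (a ++ b) ++ σ₂ ∉ otraces M := by
  intro hM
  let t₁ : (snapshot N A).Op × (snapshot N A).Ret × List (MemEv N Var Val) :=
    (SnapOp.update w, SnapRet.ack, a)
  let t₂ : (snapshot N A).Op × (snapshot N A).Ret × List (MemEv N Var Val) :=
    (SnapOp.scan, SnapRet.vec (Function.update (fun _ => ⊥) q (w : W)), b)
  let t₃ : (snapshot N A).Op × (snapshot N A).Ret × List (MemEv N Var Val) :=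
    (SnapOp.update w, SnapRet.ack, c)
  let t₄ : (snapshot N A).Op × (snapshot N A).Ret × List (MemEv N Var Val) :=
    (SnapOp.scan, SnapRet.vec (Function.update (fun _ => ⊥) p (w : W)), d)
  have hmem : memPart (opTrace p t₃ ++ opTrace p t₄) = σ₁ ++ σ₂ := by
    rw [memPart_append, memPart_opTrace, memPart_opTrace]
    exact hσ
  -- The cut of the memory events is lifted to a cut of all events of `p`.
  obtain ⟨π₁, π₂, hπ, rfl, rfl⟩ := List.filterMap_eq_append_iff.mp hmem
  have hproc : ∀ e ∈ π₁ ++ π₂, e.proc = p := by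
    rw [← hπ]
    exact fun e he => (List.mem_append.mp he).elim (hc.proc_opTrace e) (hd.proc_opTrace e)
  have hproc' : ∀ e ∈ opTrace q t₁ ++ opTrace q t₂, e.proc = q :=
    fun e he => (List.mem_append.mp he).elim (ha.proc_opTrace e) (hb.proc_opTrace e)
  obtain ⟨h, hh, hmem⟩ := hcons.exists_spec
    (fun r => if r = q then [t₁, t₂] else if r = p then [t₃, t₄] else [])
    (π := π₁ ++ (opTrace q t₁ ++ opTrace q t₂) ++ π₂) (fun r t ht => by
      split_ifs at ht with h₁ h₂
      · subst h₁
        rcases List.mem_pair.mp ht with rfl | rfl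
        exacts [ha, hb]
      · subst h₂
        rcases List.mem_pair.mp ht with rfl | rfl
        exacts [hc, hd]
      · cases ht) (fun r => by
      rw [List.filter_append, List.filter_append,
        filter_proc_eq (fun e he => hproc e (List.mem_append_left _ he)), filter_proc_eq hproc',
        filter_proc_eq (fun e he => hproc e (List.mem_append_right _ he))]
      rcases eq_or_ne r q with rfl | h₁
      · simp [hpq.symm]
      · rcases eq_or_ne r p with rfl | h₂
        · simp [hpq, ← hπ]
        · simp [h₁, h₂]) (by
      rw [memPart_append, memPart_append, memPart_append, memPart_opTrace, memPart_opTrace]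
      exact hM)
  refine false_of_scans hw hh (fun r y hy => ?_) hpq (q := p) (q' := q)
    ((hmem _).mpr ⟨t₄, by simp [hpq], .inr rfl⟩) ((hmem _).mpr ⟨t₂, by simp, .inr rfl⟩)
  obtain ⟨t, ht, hty⟩ := (hmem _).mp hy
  dsimp only at ht
  split_ifs at ht with h₁ h₂
  · rcases List.mem_pair.mp ht with rfl | rfl <;> (rcases hty with h | h <;> cases h; try rfl)
  · rcases List.mem_pair.mp ht with rfl | rfl <;> (rcases hty with h | h <;> cases h; try rfl)
  · cases ht

/-- The variant for RA: update and scan belong to different processes and are cut separately, since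
both have trailing fences to postpone. -/
theorem not_interruptible_of_ne {M : MemoryModel N Var Val} (hcons : I.Consistent M) {w : A}
    (hw : (w : W) ≠ ⊥) {p p' q : Fin N} (hpp' : p ≠ p') (hpq : p ≠ q) (hpq' : p' ≠ q)
    {a b c₁ c₂ d₁ d₂ : List (MemEv N Var Val)}
    (ha : UpdateExec I q w a) (hb : ScanExec I q q w b) (hc : UpdateExec I p w (c₁ ++ c₂))
    (hd : ScanExec I p' p w (d₁ ++ d₂)) :
    c₁ ++ d₁ ++ (a ++ b) ++ c₂ ++ d₂ ∉ otraces M := by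
  intro hM
  let t₁ : (snapshot N A).Op × (snapshot N A).Ret × List (MemEv N Var Val) :=
    (SnapOp.update w, SnapRet.ack, a)
  let t₂ : (snapshot N A).Op × (snapshot N A).Ret × List (MemEv N Var Val) :=
    (SnapOp.scan, SnapRet.vec (Function.update (fun _ => ⊥) q (w : W)), b)
  let t₃ : (snapshot N A).Op × (snapshot N A).Ret × List (MemEv N Var Val) :=
    (SnapOp.update w, SnapRet.ack, c₁ ++ c₂)
  let t₄ : (snapshot N A).Op × (snapshot N A).Ret × List (MemEv N Var Val) :=
    (SnapOp.scan, SnapRet.vec (Function.update (fun _ => ⊥) p (w : W)), d₁ ++ d₂)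
  obtain ⟨π₁, π₂, hπ, hc₁, hc₂⟩ := List.filterMap_eq_append_iff.mp (memPart_opTrace p t₃)
  obtain ⟨π₁', π₂', hπ', hd₁, hd₂⟩ := List.filterMap_eq_append_iff.mp (memPart_opTrace p' t₄)
  have hproc : ∀ e ∈ π₁ ++ π₂, e.proc = p := hπ ▸ hc.proc_opTrace
  have hproc' : ∀ e ∈ π₁' ++ π₂', e.proc = p' := hπ' ▸ hd.proc_opTrace
  have hproc'' : ∀ e ∈ opTrace q t₁ ++ opTrace q t₂, e.proc = q :=
    fun e he => (List.mem_append.mp he).elim (ha.proc_opTrace e) (hb.proc_opTrace e)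
  obtain ⟨h, hh, hmem⟩ := hcons.exists_spec
    (fun r => if r = q then [t₁, t₂] else if r = p then [t₃] else if r = p' then [t₄] else [])
    (π := π₁ ++ π₁' ++ (opTrace q t₁ ++ opTrace q t₂) ++ π₂ ++ π₂') (fun r t ht => by
      split_ifs at ht with h₁ h₂ h₃
      · subst h₁
        rcases List.mem_pair.mp ht with rfl | rfl
        exacts [ha, hb]
      · subst h₂
        rw [List.mem_singleton.mp ht]
        exact hc
      · subst h₃
        rw [List.mem_singleton.mp ht]
        exact hd
      · cases ht) (fun r => by
      rw [List.filter_append, List.filter_append, List.filter_append, List.filter_append,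
        filter_proc_eq (fun e he => hproc e (List.mem_append_left _ he)), filter_proc_eq hproc'',
        filter_proc_eq (fun e he => hproc e (List.mem_append_right _ he)),
        filter_proc_eq (fun e he => hproc' e (List.mem_append_left _ he)),
        filter_proc_eq (fun e he => hproc' e (List.mem_append_right _ he))]
      rcases eq_or_ne r q with rfl | h₁
      · simp [hpq.symm, hpq'.symm]
      · rcases eq_or_ne r p with rfl | h₂
        · simp [hpq, hpp', ← hπ]
        · rcases eq_or_ne r p' with rfl | h₃
          · simp [hpq', hpp'.symm, ← hπ']
          · simp [h₁, h₂, h₃]) (by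
      have h₁ : memPart π₁ = c₁ := hc₁
      have h₂ : memPart π₂ = c₂ := hc₂
      have h₃ : memPart π₁' = d₁ := hd₁
      have h₄ : memPart π₂' = d₂ := hd₂
      rw [memPart_append, memPart_append, memPart_append, memPart_append, memPart_append, h₁, h₂,
        h₃, h₄, memPart_opTrace, memPart_opTrace]
      exact hM)
  refine false_of_scans hw hh (fun r y hy => ?_) hpq (q := p') (q' := q)
    ((hmem _).mpr ⟨t₄, by simp [hpq', hpp'.symm], .inr rfl⟩)
    ((hmem _).mpr ⟨t₂, by simp, .inr rfl⟩)
  obtain ⟨t, ht, hty⟩ := (hmem _).mp hy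
  dsimp only at ht
  split_ifs at ht with h₁ h₂ h₃
  · rcases List.mem_pair.mp ht with rfl | rfl <;> (rcases hty with h | h <;> cases h; try rfl)
  · rw [List.mem_singleton.mp ht] at hty
    rcases hty with h | h <;> cases h
    rfl
  · rw [List.mem_singleton.mp ht] at hty
    rcases hty with h | h <;> cases h
  · cases ht

end Main

end WeakMem

theorem mainTheorem4 {N : ℕ} {Var : Type*} {Val : Type*} [Zero Val]
    {W : Type*} [Bot W] (A : Set W) (hA : ∃ w ∈ A, w ≠ ⊥)
    (M : Model) (hN : 2 ≤ N) (hRA : M = .RA → 3 ≤ N)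
    (I : Implementation Var Val (snapshot N A))
    (havail : I.SpecAvailable) (hcons : I.Consistent (M.lts N Var Val)) :
    ∃ (p p' : Fin N) (w : A),
      ∃ π₁ ∈ (I (SnapOp.update w) p).traces, ∃ π₂ ∈ (I SnapOp.scan p').traces,
        (M = .SCM →
          HasRMW (memPart π₁ ++ memPart π₂) ∨ ¬ IsRBW (memPart π₁ ++ memPart π₂)) ∧
        (M = .TSO →
          HasRMW (memPart π₁ ++ memPart π₂) ∨ ¬ IsLTF (memPart π₁ ++ memPart π₂)) ∧
        (M = .RA →
          (HasRMW (memPart π₁) ∨ HasRMW (memPart π₂)) ∨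
            (¬ IsLTF (memPart π₁) ∨ ¬ IsLTF (memPart π₂))) := by
  obtain ⟨w, hwA, hw⟩ := hA
  lift w to A using hwA
  by_contra hneg
  -- `hneg` applies to every pair of executions, not just to one; RA needs it for two pairs.
  have key : ∀ {p p' i : Fin N} {ms ms' : List (MemEv N Var Val)}, UpdateExec I p w ms →
      ScanExec I p' i w ms' →
      ¬ ((M = .SCM → HasRMW (ms ++ ms') ∨ ¬ IsRBW (ms ++ ms')) ∧
        (M = .TSO → HasRMW (ms ++ ms') ∨ ¬ IsLTF (ms ++ ms')) ∧
        (M = .RA → (HasRMW ms ∨ HasRMW ms') ∨ (¬ IsLTF ms ∨ ¬ IsLTF ms'))) := by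
    intro p p' i ms ms' h h' hms
    refine hneg ⟨p, p', w, _, h, _, h', ?_⟩
    simpa only [Implementation.memPart_map_mem_append_obj] using hms
  have h01 : (⟨1, hN⟩ : Fin N) ≠ ⟨0, by omega⟩ := by simp
  -- The interrupting run, by process 0 in all three models.
  obtain ⟨a, b, m, ha, hb, hab⟩ := exists_update_scan havail w ⟨0, by omega⟩ ⟨0, by omega⟩
  have hproc : ∀ e ∈ a ++ b, e.1 = ⟨0, by omega⟩ := fun e he =>
    (List.mem_append.mp he).elim (ha.proc_mem e) (hb.proc_mem e)
  cases M with
  | SCM =>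
    obtain ⟨c, d, m', hc, hd, hcd⟩ := exists_update_scan havail w ⟨1, hN⟩ ⟨1, hN⟩
    obtain ⟨hr, hrbw⟩ : ¬ HasRMW (c ++ d) ∧ IsRBW (c ++ d) := by simpa using key hc hd
    obtain ⟨σ₁, σ₂, hσ, hM⟩ := scm_interrupt hrbw hr hcd hab
    exact not_interruptible hcons hw h01 ha hb hc hd hσ hM
  | TSO =>
    obtain ⟨c, d, m', hc, hd, hcd⟩ := exists_update_scan havail w ⟨1, hN⟩ ⟨1, hN⟩
    obtain ⟨hr, hltf⟩ : ¬ HasRMW (c ++ d) ∧ IsLTF (c ++ d) := by simpa using key hc hd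
    obtain ⟨σ₁, σ₂, hσ, hM⟩ := tso_interrupt h01 hltf hr hcd
      (fun e he => (List.mem_append.mp he).elim (hc.proc_mem e) (hd.proc_mem e)) hab hproc
    exact not_interruptible hcons hw h01 ha hb hc hd hσ hM
  | RA =>
    have h3 := hRA rfl
    have h12 : (⟨1, hN⟩ : Fin N) ≠ ⟨2, h3⟩ := by simp
    have h02 : (⟨2, h3⟩ : Fin N) ≠ ⟨0, by omega⟩ := by simp
    -- Two processes, because `c` and `d` are LTF only separately: in `c ++ d`, fences may lie in
    -- the middle.
    obtain ⟨c, d, m', hc, hd, hcd⟩ := exists_update_scan havail w ⟨1, hN⟩ ⟨2, h3⟩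
    obtain ⟨⟨hrc, hrd⟩, hlc, hld⟩ :
        (¬ HasRMW c ∧ ¬ HasRMW d) ∧ IsLTF c ∧ IsLTF d := by simpa using key hc hd
    -- Under RA the interrupting run must be free of RMWs as well.
    obtain ⟨⟨hra, hrb⟩, -⟩ :
        (¬ HasRMW a ∧ ¬ HasRMW b) ∧ IsLTF a ∧ IsLTF b := by simpa using key ha hb
    have hrab : ¬ HasRMW (a ++ b) := fun ⟨p, x, v, v', h⟩ =>
      (List.mem_append.mp h).elim (fun h => hra ⟨p, x, v, v', h⟩) fun h => hrb ⟨p, x, v, v', h⟩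
    obtain ⟨c₁, c₂, d₁, d₂, rfl, rfl, hM⟩ := ra_interrupt h12 h01 h02 hlc hld hrc hrd hrab hcd
      hc.proc_mem hd.proc_mem hab hproc
    exact not_interruptible_of_ne hcons hw h12 h01 h02 ha hb hc hd hM
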